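/- Let $\mathrm{Tr}$ be the absolute trace $\mathrm{GF}(32)\to\mathrm{GF}(2)$. For $\alpha,\beta,\lambda\in\mathrm{GF}(32)$ with $\mathrm{Tr}(\alpha\beta)=1$ and $\lambda\neq0$ let $F_{\alpha,\beta,\lambda}$ be the conic $\alpha x^2+xy+\beta y^2+\lambda z^2=0$ of $\mathrm{PG}(2,32)$; its nucleus is $(0,0,1)$. For $\lambda\ne\lambda'$ put $$F_{\alpha,\beta,\lambda}\oplus F_{\alpha',\beta',\lambda'}=F_{\frac{\alpha\lambda+\alpha'\lambda'}{\lambda+\lambda'},\,\frac{\beta\lambda+\beta'\lambda'}{\lambda+\lambda'},\,\lambda+\lambda'} .$$ A set $\mathcal C$ of such conics is closed if any two distinct members have distinct $\lambda$ and their composition $\oplus$ is again a member of $\mathcal C$ (in particular it satisfies the trace condition). Let $K(\mathcal C)$ be the union of the conics of $\mathcal C$ together with the point $(0,0,1)$. A maximal arc of degree $d$ is a non-empty proper set of points which every line meets in $0$ or $d$ points. Two point sets are isomorphic if an element of $\mathrm{P\Gamma L}(3,32)$ maps one onto the other. A maximal arc is a Mathon arc if it is isomorphic to some $K(\mathcal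 C)$ with $\mathcal C$ closed. It is of Denniston type if it is isomorphic to some $K(\{F_{\alpha,1,\lambda}:\lambda\in A\setminus\{0\}\})$ with $\mathrm{Tr}(\alpha)=1$ and $A$ an additive subgroup of $\mathrm{GF}(32)$. A Mathon arc that is not of Denniston type is called proper. Then there are exactly three isomorphism classes of proper Mathon arcs of degree $8$ in $\mathrm{PG}(2,32)$. Moreover, there is a primitive element $w$ of $\mathrm{GF}(32)$ with $w^{18}+w=1$, and for every such $w$ the following holds. For each of the exponents $(k,l,m)=(12,15,4),\ (5,25,14),\ (6,19,8)$ the set $$\mathcal C_{k,l,m}=\{x^2+xy+(w^k+w^l\lambda+w^m\lambda^3)y^2+\lambda z^2=0 \;:\; \lambda\in\langle1,w,w^9\rangle\setminus\{0\}\},$$ where $\langle1,w,w^9\rangle$ is the additive group generated by $1,w,w^9$, is a closed set of seven conics, and $K(\mathcal C_{k,l,m})$ is a proper Mathon arc of degree $8$. These three arcs are pairwise non-isomorphic, and every proper Mathon arc of degree $8$ in $\mathrm{PG}(2,32)$ is isomorphic to one of them. The conics of $\mathcal C_{6,19,8}$ are the seven conics $x^2+xy+\beta y^2+\lambda z^2=0$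 with $$(\beta,\lambda)=(1,1),\ (1,w),\ (1,w+1),\ (w^{12},w^{25}),\ (w^{6},w^{21}),\ (w^{18},w^{16}),\ (w^{20},w^{9}).$$ -/

import Mathlib

/-- The points of `PG(2, K)`: one-dimensional subspaces of `K³`. -/
abbrev PG2 (K : Type*) [Field K] : Type _ := Projectivization K (Fin 3 → K)

namespace PG2

variable {K : Type*} [Field K]

/-- The collineations of `PG(2, K)`, i.e. the elements of `PΓL(3, K)`: the maps induced by a
bijection of `K³` that is semilinear with respect to a field automorphism `σ`. -/
def IsCollineation (g : PG2 K → PG2 K) : Prop :=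
  ∃ (σ : K ≃+* K) (f : (Fin 3 → K) →ₛₗ[(σ : K →+* K)] (Fin 3 → K)) (hf : Function.Bijective f),
    g = Projectivization.map f hf.injective

/-- Two point sets are isomorphic if a collineation of the plane maps one onto the other. -/
def Iso (S T : Set (PG2 K)) : Prop := ∃ g : PG2 K → PG2 K, IsCollineation g ∧ g '' S = T

/-- A maximal arc of degree `d`: a non-empty proper set of points that every line `[u, v, w]`
(a triple up to scalars, incident with `(a, b, c)` iff `au + bv + cw = 0`) meets in `0` or in
`d` points. -/
def IsMaximalArc (d : ℕ) (S : Set (PG2 K)) : Prop :=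
  S.Nonempty ∧ S ≠ Set.univ ∧
    ∀ l : PG2 K, {P ∈ S | Projectivization.orthogonal P l}.ncard = 0 ∨
      {P ∈ S | Projectivization.orthogonal P l}.ncard = d

/-- The parameters of the form `α x² + x y + β y² + lam z²`. -/
@[ext]
structure ConicForm (K : Type*) where
  α : K
  β : K
  lam : K

namespace ConicForm

/-- The zero set of the form in the plane. -/
def points (c : ConicForm K) : Set (PG2 K) :=
  {P | c.α * P.rep 0 ^ 2 + P.rep 0 * P.rep 1 + c.β * P.rep 1 ^ 2 + c.lam * P.rep 2 ^ 2 = 0}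

/-- Membership in the zero set does not depend on the representing vector. -/
theorem mk_mem_points (c : ConicForm K) (v : Fin 3 → K) (hv : v ≠ 0) :
    Projectivization.mk K v hv ∈ c.points ↔
      c.α * v 0 ^ 2 + v 0 * v 1 + c.β * v 1 ^ 2 + c.lam * v 2 ^ 2 = 0 := by
  obtain ⟨a, ha⟩ := Projectivization.exists_smul_eq_mk_rep K v hv
  have h : ∀ i, (Projectivization.mk K v hv).rep i = (a : K) * v i := by
    intro i
    rw [← ha]
    rfl
  have ha0 : (a : K) ^ 2 ≠ 0 := pow_ne_zero 2 a.ne_zero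
  simp only [points, Set.mem_ofPred_eq, h]
  rw [show c.α * ((a : K) * v 0) ^ 2 + (a : K) * v 0 * ((a : K) * v 1) +
      c.β * ((a : K) * v 1) ^ 2 + c.lam * ((a : K) * v 2) ^ 2 = (a : K) ^ 2 *
      (c.α * v 0 ^ 2 + v 0 * v 1 + c.β * v 1 ^ 2 + c.lam * v 2 ^ 2) by ring]
  simp [ha0]

/-- The forms of Mathon's family that define conics: `α β` has absolute trace `1` and
`lam ≠ 0`. -/
def IsMathonConic [Algebra (ZMod 2) K] (c : ConicForm K) : Prop :=
  Algebra.trace (ZMod 2) K (c.α * c.β) = 1 ∧ c.lam ≠ 0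

/-- Mathon's composition (of two forms with different values of `lam`). -/
def comp (c c' : ConicForm K) : ConicForm K where
  α := (c.α * c.lam + c'.α * c'.lam) / (c.lam + c'.lam)
  β := (c.β * c.lam + c'.β * c'.lam) / (c.lam + c'.lam)
  lam := c.lam + c'.lam

end ConicForm

/-- A set of conics of Mathon's family that is closed under composition: for any two distinct
members the composition is defined and is again a member. -/
def IsClosedConicSet [Algebra (ZMod 2) K] (C : Set (ConicForm K)) : Prop :=
  (∀ c ∈ C, c.IsMathonConic) ∧
    ∀ c ∈ C, ∀ c' ∈ C, c ≠ c' → c.lam ≠ c'.lam ∧ c.comp c' ∈ C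

/-- The point `(0, 0, 1)`, the common nucleus of the conics. -/
def nucleus (K : Type*) [Field K] : PG2 K :=
  Projectivization.mk K ![0, 0, 1] (fun h => one_ne_zero (congrFun h 2))

/-- The points of the conics in `C` together with their common nucleus. -/
def arcOfConics (C : Set (ConicForm K)) : Set (PG2 K) :=
  insert (nucleus K) (⋃ c ∈ C, c.points)

/-- Up to a change of coordinates, `S` comes from a closed set of conics. -/
def IsMathonType [Algebra (ZMod 2) K] (S : Set (PG2 K)) : Prop :=
  ∃ C : Set (ConicForm K), IsClosedConicSet C ∧ Iso (arcOfConics C) S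

/-- The conics `α x² + x y + y² + lam z² = 0` with `lam ≠ 0` in an additive subgroup `A`. -/
def dennistonConics (α : K) (A : AddSubgroup K) : Set (ConicForm K) :=
  {c | ∃ lam ∈ A, lam ≠ 0 ∧ c = ⟨α, 1, lam⟩}

/-- Up to a change of coordinates, `S` comes from Denniston's construction. -/
def IsDennistonType [Algebra (ZMod 2) K] (S : Set (PG2 K)) : Prop :=
  ∃ (α : K) (A : AddSubgroup K), Algebra.trace (ZMod 2) K α = 1 ∧
    Iso (arcOfConics (dennistonConics α A)) S

/-- A proper Mathon arc of degree `d`. -/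
def IsProperMathonArc [Algebra (ZMod 2) K] (d : ℕ) (S : Set (PG2 K)) : Prop :=
  IsMaximalArc d S ∧ IsMathonType S ∧ ¬ IsDennistonType S

theorem Iso.refl (S : Set (PG2 K)) : Iso S S := by
  refine ⟨id, ⟨RingEquiv.refl K, ⟨⟨id, fun _ _ => rfl⟩, fun _ _ => rfl⟩,
    Function.bijective_id, ?_⟩, Set.image_id S⟩
  funext P
  induction P using Projectivization.ind with
  | h v hv => rfl

theorem Iso.symm {S T : Set (PG2 K)} : Iso S T → Iso T S := by
  rintro ⟨g, ⟨σ, f, hf, rfl⟩, rfl⟩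
  let e := Equiv.ofBijective f hf
  have he : ∀ x, f (e.symm x) = x := e.apply_symm_apply
  let f' : (Fin 3 → K) →ₛₗ[(σ.symm : K →+* K)] (Fin 3 → K) :=
    ⟨⟨e.symm, fun x y => hf.injective (by simp [he])⟩,
      fun a x => hf.injective (by simp [he])⟩
  refine ⟨_, ⟨σ.symm, f', e.symm.bijective, rfl⟩, ?_⟩
  have h : ∀ P : PG2 K, Projectivization.map f' e.symm.bijective.injective
      (Projectivization.map f hf.injective P) = P := by
    intro P
    induction P using Projectivization.ind with
    | h v hv =>
      simp only [Projectivization.map_mk]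
      congr 1
      exact e.symm_apply_apply v
  rw [Set.image_image]
  simp only [h, Set.image_id']

theorem Iso.trans {S T U : Set (PG2 K)} : Iso S T → Iso T U → Iso S U := by
  rintro ⟨g, ⟨σ, f, hf, rfl⟩, rfl⟩ ⟨g', ⟨τ, f', hf', rfl⟩, rfl⟩
  let k : (Fin 3 → K) →ₛₗ[((σ.trans τ : K ≃+* K) : K →+* K)] (Fin 3 → K) :=
    ⟨⟨fun x => f' (f x), fun x y => by simp⟩, fun a x => by simp⟩
  refine ⟨_, ⟨σ.trans τ, k, hf'.comp hf, rfl⟩, ?_⟩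
  rw [Set.image_image]
  congr 1
  funext P
  induction P using Projectivization.ind with
  | h v hv => rfl

/-- Isomorphism as an equivalence relation on the proper Mathon arcs of degree `d`. -/
def properMathonSetoid (K : Type*) [Field K] [Algebra (ZMod 2) K] (d : ℕ) :
    Setoid {S : Set (PG2 K) // IsProperMathonArc d S} where
  r S T := Iso S.1 T.1
  iseqv := ⟨fun S => Iso.refl S.1, Iso.symm, Iso.trans⟩

/-- The isomorphism classes of proper Mathon arcs of degree `d` in `PG(2, K)`. -/
def ProperMathonClasses (K : Type*) [Field K] [Algebra (ZMod 2) K] (d : ℕ) : Type _ :=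
  Quotient (properMathonSetoid K d)

/-- The conics `x² + x y + (w^k + w^l λ + w^m λ³) y² + λ z² = 0`, where `λ` runs through the
non-zero elements of the additive group generated by `1`, `w`, `w⁹`; here `e = (k, l, m)`. -/
def mathonConics (w : K) (e : ℕ × ℕ × ℕ) : Set (ConicForm K) :=
  {c | ∃ lam ∈ AddSubgroup.closure ({1, w, w ^ 9} : Set K), lam ≠ 0 ∧
    c = ⟨1, w ^ e.1 + w ^ e.2.1 * lam + w ^ e.2.2 * lam ^ 3, lam⟩}

/-- The exponents `(k, l, m)` of Mathon's three arcs. -/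
def mathonExponents : Finset (ℕ × ℕ × ℕ) := {(12, 15, 4), (5, 25, 14), (6, 19, 8)}

end PG2

/-! In a closed set of seven conics the values of `lam`, together with `0`, form an additive group
`A` of order `8`, and `α * lam`, `β * lam` are additive functions on `A`. By a dimension count these
are polynomials `p₀ l + p₁ l² + p₂ l⁴`, so every closed set of this size is a `cubicFamily`
(`IsClosedConicSet.exists_eq_cubicFamily`). The line `z = u x + v y` is secant or external to the
conic with parameter `l` according to the trace of an additive function of `l`; hence it meets none
or half of the conics, each of those in two points, and the union is a maximal arc of degree `8`
(`isMaximalArc_cubicFamily`).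

A collineation between two such arcs maps conics to conics (`Iso.exists_matching`): of the 33 points
of a conic, five must land on one of the seven target conics, and five points determine a conic. The
nucleus is then fixed, and comparing coefficients relates the parameters (`Iso.exists_relation`).
The linear coefficients carry no information, since `z ↦ z + e x + f y` adds multiples of `lam` to
`α` and `β`.

For the classification, a substitution in `SL(2)` kills `p₂`. Then `ΓL(1, 32)`, which permutes the
subgroups of order `8` regularly, moves `A` to the group generated by `1, w, w⁹`. After that only `c
= p₀ q₂` matters (`iso_normal_form`). If `c = 0` the arc is of Denniston type. Otherwise the trace
conditions at `l`, `m`, `l + m` add up to `Tr (p₀ q₀) + Tr (c l m (l + m)) = 1`, and four such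
triples leave only `c = w⁴, w¹⁴, w⁸`. These are the values `w^m` of the three listed families. An
isomorphism between two of them must have trivial action on the parameter group and then preserves
`c`, so the three classes are distinct. -/

namespace PG2

local notation "Tr" => Algebra.trace (ZMod 2)

/-! ### Traces and binary quadratic forms over GF(32). -/

section Field

theorem charP_two (K : Type*) [Field K] [Algebra (ZMod 2) K] : CharP K 2 :=
  charP_of_injective_algebraMap (algebraMap (ZMod 2) K).injective 2

variable {K : Type*} [Field K]

theorem sq_injective [CharP K 2] {x y : K} (h : x ^ 2 = y ^ 2) : x = y := by
  have h1 : (x + y) ^ 2 = 0 := by grind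
  have := pow_eq_zero_iff (two_ne_zero) |>.1 h1
  grind

variable [Fintype K]

theorem pow_thirtyTwo (hK : Fintype.card K = 32) (x : K) : x ^ 32 = x := by
  rw [← hK]
  exact FiniteField.pow_card x

theorem exists_sq_eq (hK : Fintype.card K = 32) (x : K) : ∃ y, y ^ 2 = x :=
  ⟨x ^ 16, by rw [← pow_mul]; exact pow_thirtyTwo hK x⟩

variable [Algebra (ZMod 2) K]

theorem zmod_two_eq_zero_or_one (a : ZMod 2) : a = 0 ∨ a = 1 := by
  revert a
  decide

theorem finrank_eq_five (hK : Fintype.card K = 32) : Module.finrank (ZMod 2) K = 5 := by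
  have h := Module.card_eq_pow_finrank (K := ZMod 2) (V := K)
  rw [hK, ZMod.card] at h
  exact (Nat.pow_right_injective le_rfl (show 2 ^ 5 = 2 ^ _ from h)).symm

theorem algebraMap_trace_eq (hK : Fintype.card K = 32) (x : K) :
    algebraMap (ZMod 2) K (Tr K x) = x + x ^ 2 + x ^ 4 + x ^ 8 + x ^ 16 := by
  rw [FiniteField.algebraMap_trace_eq_sum_pow, finrank_eq_five hK]
  simp [Finset.sum_range_succ]

theorem trace_eq_one_iff (hK : Fintype.card K = 32) (x : K) :
    Tr K x = 1 ↔ x + x ^ 2 + x ^ 4 + x ^ 8 + x ^ 16 = 1 := by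
  rw [← algebraMap_trace_eq hK, map_eq_one_iff _ (algebraMap (ZMod 2) K).injective]

theorem trace_eq_zero_iff (hK : Fintype.card K = 32) (x : K) :
    Tr K x = 0 ↔ x + x ^ 2 + x ^ 4 + x ^ 8 + x ^ 16 = 0 := by
  rw [← algebraMap_trace_eq hK, map_eq_zero_iff _ (algebraMap (ZMod 2) K).injective]

theorem trace_ringEquiv (hK : Fintype.card K = 32) (σ : K ≃+* K) (x : K) :
    Tr K (σ x) = Tr K x := by
  rcases zmod_two_eq_zero_or_one (Tr K x) with h | h <;> rw [h]
  · rw [trace_eq_zero_iff hK] at h ⊢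
    simpa using congrArg σ h
  · rw [trace_eq_one_iff hK] at h ⊢
    simpa using congrArg σ h

theorem trace_sq (hK : Fintype.card K = 32) (x : K) : Tr K (x ^ 2) = Tr K x := by
  have := charP_two K
  apply (algebraMap (ZMod 2) K).injective
  rw [algebraMap_trace_eq hK, algebraMap_trace_eq hK]
  have := pow_thirtyTwo hK x
  grind

theorem trace_one (hK : Fintype.card K = 32) : Tr K (1 : K) = 1 := by
  have := charP_two K
  rw [trace_eq_one_iff hK]
  grind

theorem exists_sq_add_self_eq (hK : Fintype.card K = 32) {x : K} (hx : Tr K x = 0) :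
    ∃ y, y ^ 2 + y = x := by
  have := charP_two K
  rw [trace_eq_zero_iff hK] at hx
  have := pow_thirtyTwo hK x
  -- The half-trace, available because the extension degree 5 is odd: `y² + y` is the trace of `x`
  -- plus `x³²`.
  refine ⟨x + x ^ 4 + x ^ 16, ?_⟩
  grind

/-- A binary form `a x² + x y + b y²` with a non-trivial zero has `Tr (a b) = 0`. -/
theorem trace_mul_eq_zero_of_zero (hK : Fintype.card K = 32) {a b x y : K}
    (hxy : x ≠ 0 ∨ y ≠ 0) (h : a * x ^ 2 + x * y + b * y ^ 2 = 0) : Tr K (a * b) = 0 := by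
  have := charP_two K
  by_cases hy : y = 0
  · subst hy
    have ha : a = 0 := by grind
    simp [ha]
  · have : a * b = (a * x / y) ^ 2 + a * x / y := by
      field_simp
      grind
    rw [this, map_add, trace_sq hK, CharTwo.add_self_eq_zero]

/-- A binary form `a x² + x y + b y²` with `Tr (a b) = 0` has two distinct linear factors. -/
theorem exists_factorization (hK : Fintype.card K = 32) {a b : K} (h : Tr K (a * b) = 0) :
    ∃ k x₁ y₁ x₂ y₂ : K, k ≠ 0 ∧ x₁ * y₂ ≠ x₂ * y₁ ∧ ∀ x y,
      a * x ^ 2 + x * y + b * y ^ 2 = k * (x * y₁ - x₁ * y) * (x * y₂ - x₂ * y) := by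
  have := charP_two K
  by_cases ha : a = 0
  · exact ⟨1, 1, 0, b, 1, one_ne_zero, by simp, fun x y => by subst ha; grind⟩
  · obtain ⟨t, ht⟩ := exists_sq_add_self_eq hK h
    refine ⟨a, t / a, 1, (t + 1) / a, 1, ha, fun h => ?_, fun x y => ?_⟩
    · field_simp at h
      grind
    · field_simp
      grind

/-- The product `l² u² v²` is the square of `l u v`, so it has the same trace. Substituting `z = u x
+ v y` in a conic gives a binary form whose splitting is governed by the left side; the right side
is additive in `l` as soon as `l * a` and `l * b` are. -/
theorem trace_line (hK : Fintype.card K = 32) {a b l : K} (h : Tr K (a * b) = 1) (u v : K) :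
    Tr K ((a + l * u ^ 2) * (b + l * v ^ 2)) =
      1 + Tr K (l * b * u ^ 2 + l * a * v ^ 2 + l * u * v) := by
  rw [show (a + l * u ^ 2) * (b + l * v ^ 2) =
    a * b + (l * b * u ^ 2 + l * a * v ^ 2) + (l * u * v) ^ 2 by ring]
  simp only [map_add, trace_sq hK, h]
  ring

end Field

/-- The value of the form at a vector. -/
def ConicForm.eval {K : Type*} [Field K] (c : ConicForm K) (v : Fin 3 → K) : K :=
  c.α * v 0 ^ 2 + v 0 * v 1 + c.β * v 1 ^ 2 + c.lam * v 2 ^ 2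

/-! ### Composition of conics and disjointness. -/

section Conics

variable {K : Type*} [Field K]

theorem mk_mem_arcOfConics (C : Set (ConicForm K)) (v : Fin 3 → K) (hv : v ≠ 0) :
    Projectivization.mk K v hv ∈ arcOfConics C ↔
      (v 0 = 0 ∧ v 1 = 0) ∨ ∃ c ∈ C, c.eval v = 0 := by
  unfold arcOfConics nucleus
  rw [Set.mem_insert_iff, Projectivization.mk_eq_mk_iff']
  simp only [Set.mem_iUnion, ConicForm.mk_mem_points, ConicForm.eval, exists_prop]
  refine or_congr_left ⟨?_, fun h => ⟨v 2, ?_⟩⟩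
  · rintro ⟨a, rfl⟩
    simp
  · ext i
    fin_cases i <;> simp [h]

variable [Algebra (ZMod 2) K]

/-- Up to a scalar, the composition lies in the pencil of the two forms, so it vanishes at their
common zeros. -/
theorem ConicForm.comp_eval (c c' : ConicForm K) (h : c.lam ≠ c'.lam) (v : Fin 3 → K) :
    (c.lam + c'.lam) * (c.comp c').eval v = c.lam * c.eval v + c'.lam * c'.eval v := by
  have := charP_two K
  have h0 : c.lam + c'.lam ≠ 0 := by grind
  simp only [ConicForm.eval, ConicForm.comp]
  field_simp
  grind

theorem ConicForm.IsMathonConic.fst_or_snd_ne_zero {c : ConicForm K} (hc : c.IsMathonConic)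
    {v : Fin 3 → K} (hv : v ≠ 0) (h : c.eval v = 0) : v 0 ≠ 0 ∨ v 1 ≠ 0 := by
  by_contra! h0
  have h2 : v 2 = 0 := by simpa [ConicForm.eval, h0, hc.2] using h
  exact hv (by ext i; fin_cases i <;> simp [h0, h2])

variable [Fintype K]

theorem ConicForm.IsMathonConic.trace_eq_one (hK : Fintype.card K = 32) {c : ConicForm K}
    (hc : c.IsMathonConic) {x y u v : K} (hxy : x ≠ 0 ∨ y ≠ 0)
    (h : c.eval ![x, y, u * x + v * y] = 0) :
    Tr K (c.lam * c.β * u ^ 2 + c.lam * c.α * v ^ 2 + c.lam * u * v) = 1 := by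
  have := charP_two K
  have h2 : (2 : K) = 0 := CharTwo.two_eq_zero
  have h0 : (c.α + c.lam * u ^ 2) * x ^ 2 + x * y + (c.β + c.lam * v ^ 2) * y ^ 2 = 0 := by
    simp only [ConicForm.eval, Matrix.cons_val] at h
    linear_combination h - c.lam * u * v * x * y * h2
  have h1 := trace_mul_eq_zero_of_zero hK hxy h0
  rw [trace_line hK hc.1] at h1
  exact (CharTwo.add_eq_zero.1 h1).symm

/-- Distinct conics of a closed set have no point in common. -/
theorem IsClosedConicSet.eq_of_eval_eq_zero (hK : Fintype.card K = 32) {C : Set (ConicForm K)}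
    (hC : IsClosedConicSet C) {c c' : ConicForm K} (hc : c ∈ C) (hc' : c' ∈ C) {v : Fin 3 → K}
    (hv : v ≠ 0) (h : c.eval v = 0) (h' : c'.eval v = 0) : c = c' := by
  have := charP_two K
  by_contra hne
  obtain ⟨hl, hcc⟩ := hC.2 c hc c' hc' hne
  have hl0 : c.lam + c'.lam ≠ 0 := by grind
  have hxy := (hC.1 c hc).fst_or_snd_ne_zero hv h
  have h'' : (c.comp c').eval v = 0 := by
    have := c.comp_eval c' hl v
    rw [h, h'] at this
    simpa [hl0] using this
  obtain ⟨u, w, huw⟩ : ∃ u w, v 2 = u * v 0 + w * v 1 := by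
    rcases hxy with h0 | h0
    · exact ⟨v 2 / v 0, 0, by field_simp; ring⟩
    · exact ⟨0, v 2 / v 1, by field_simp; ring⟩
  have hv' : v = ![v 0, v 1, u * v 0 + w * v 1] := by
    rw [← huw]
    ext i
    fin_cases i <;> rfl
  rw [hv'] at h h' h''
  have t := (hC.1 c hc).trace_eq_one hK hxy h
  have t' := (hC.1 c' hc').trace_eq_one hK hxy h'
  have t'' := (hC.1 _ hcc).trace_eq_one hK hxy h''
  -- A common point would lie on all three conics, and on a line off the nucleus. The three traces
  -- attached to that line are all `1`, while the third is the sum of the other two.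
  have key : (c.comp c').lam * (c.comp c').β * u ^ 2 + (c.comp c').lam * (c.comp c').α * w ^ 2 +
      (c.comp c').lam * u * w = (c.lam * c.β * u ^ 2 + c.lam * c.α * w ^ 2 + c.lam * u * w) +
      (c'.lam * c'.β * u ^ 2 + c'.lam * c'.α * w ^ 2 + c'.lam * u * w) := by
    simp only [ConicForm.comp]
    field_simp
    ring
  rw [key, map_add, t, t'] at t''
  exact absurd t'' (by decide)

end Conics

/-! ### Families with additive coefficient functions. -/

section Family

variable {K : Type*} [Field K]

/-- The conic with parameter `l` whose coefficients `α`, `β` are the polynomials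
`p₀ + p₁ l + p₂ l³` and `q₀ + q₁ l + q₂ l³`. -/
def cubicConic (p q : Fin 3 → K) (l : K) : ConicForm K :=
  ⟨p 0 + p 1 * l + p 2 * l ^ 3, q 0 + q 1 * l + q 2 * l ^ 3, l⟩

/-- The conics `cubicConic p q l` with `l` in `A \ {0}`. -/
def cubicFamily (A : AddSubgroup K) (p q : Fin 3 → K) : Set (ConicForm K) :=
  {c | ∃ l ∈ A, l ≠ 0 ∧ c = cubicConic p q l}

theorem cubicConic_injective (p q : Fin 3 → K) : Function.Injective (cubicConic p q) :=
  fun _ _ h => congrArg ConicForm.lam h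

theorem cubicFamily_eq_image (A : AddSubgroup K) (p q : Fin 3 → K) :
    cubicFamily A p q = cubicConic p q '' ((A : Set K) \ {0}) := by
  ext c
  simp only [cubicFamily, Set.mem_ofPred_eq, Set.mem_image, Set.mem_sdiff, SetLike.mem_coe,
    Set.mem_singleton_iff, and_assoc]
  exact exists_congr fun l => by rw [eq_comm (a := c)]

theorem dennistonConics_eq_cubicFamily (α : K) (A : AddSubgroup K) :
    dennistonConics α A = cubicFamily A ![α, 0, 0] ![1, 0, 0] := by
  ext c
  simp [dennistonConics, cubicFamily, cubicConic]

theorem mathonConics_eq_cubicFamily (w : K) (e : ℕ × ℕ × ℕ) :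
    mathonConics w e = cubicFamily (AddSubgroup.closure {1, w, w ^ 9}) ![1, 0, 0]
      ![w ^ e.1, w ^ e.2.1, w ^ e.2.2] := by
  ext c
  simp [mathonConics, cubicFamily, cubicConic]

theorem ncard_cubicFamily [Finite K] (A : AddSubgroup K) (p q : Fin 3 → K) :
    (cubicFamily A p q).ncard = Nat.card A - 1 := by
  rw [cubicFamily_eq_image, Set.ncard_image_of_injective _ (cubicConic_injective p q),
    Set.ncard_sdiff_singleton_of_mem A.zero_mem, ← Nat.card_coe_set_eq]
  rfl

/-- The additive polynomial `p₀ l + p₁ l² + p₂ l⁴`. -/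
def additivePoly [CharP K 2] (p : Fin 3 → K) : K →+ K where
  toFun l := p 0 * l + p 1 * l ^ 2 + p 2 * l ^ 4
  map_zero' := by ring
  map_add' x y := by grind

theorem additivePoly_apply [CharP K 2] (p : Fin 3 → K) (l : K) :
    additivePoly p l = p 0 * l + p 1 * l ^ 2 + p 2 * l ^ 4 := rfl

/-- Closure under composition is automatic, because `l * α` and `l * β` are additive polynomials in
`l`; only the trace condition remains. -/
theorem isClosedConicSet_cubicFamily_iff [Algebra (ZMod 2) K] (A : AddSubgroup K)
    (p q : Fin 3 → K) : IsClosedConicSet (cubicFamily A p q) ↔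
      ∀ l ∈ A, l ≠ 0 → Tr K ((cubicConic p q l).α * (cubicConic p q l).β) = 1 := by
  have := charP_two K
  constructor
  · exact fun h l hl h0 => (h.1 _ ⟨l, hl, h0, rfl⟩).1
  · refine fun h => ⟨?_, ?_⟩
    · rintro _ ⟨l, hl, h0, rfl⟩
      exact ⟨h l hl h0, h0⟩
    · rintro _ ⟨l, hl, h0, rfl⟩ _ ⟨m, hm, h1, rfl⟩ hne
      have hlm : l ≠ m := fun h => hne (by rw [h])
      have h0 : l + m ≠ 0 := by grind
      refine ⟨hlm, l + m, A.add_mem hl hm, h0, ?_⟩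
      ext <;> simp only [cubicConic, ConicForm.comp]
      · field_simp
        grind
      · field_simp
        grind

end Family

/-- Translation by an element of `A` with value `1` exchanges the two fibres. It counts the conics
met by a line. -/
theorem ncard_fiber_one {M : Type*} [AddCommGroup M] [Finite M] (A : AddSubgroup M)
    (L : M →+ ZMod 2) :
    {l ∈ (A : Set M) | L l = 1}.ncard = 0 ∨ 2 * {l ∈ (A : Set M) | L l = 1}.ncard = Nat.card A := by
  by_cases h : ∃ a ∈ A, L a = 1
  · right
    obtain ⟨a, ha, hLa⟩ := h
    have himg : (a + ·) '' {l ∈ (A : Set M) | L l = 1} = {l ∈ (A : Set M) | L l = 0} := by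
      ext x
      simp only [Set.mem_image, Set.mem_ofPred_eq, SetLike.mem_coe]
      constructor
      · rintro ⟨l, ⟨hl, h1⟩, rfl⟩
        exact ⟨A.add_mem ha hl, by rw [map_add, hLa, h1]; decide⟩
      · rintro ⟨hx, h0⟩
        exact ⟨-a + x, ⟨A.add_mem (A.neg_mem ha) hx, by rw [map_add, map_neg, hLa, h0]; decide⟩,
          by simp⟩
    have hcard := Set.ncard_image_of_injective {l ∈ (A : Set M) | L l = 1} (add_right_injective a)
    rw [himg] at hcard
    have hu : {l ∈ (A : Set M) | L l = 1} ∪ {l ∈ (A : Set M) | L l = 0} = A := by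
      ext x
      have := zmod_two_eq_zero_or_one (L x)
      simp only [Set.mem_union, Set.mem_ofPred_eq, SetLike.mem_coe]
      tauto
    have hd : Disjoint {l ∈ (A : Set M) | L l = 1} {l ∈ (A : Set M) | L l = 0} := by
      rw [Set.disjoint_left]
      rintro x ⟨-, h1⟩ ⟨-, h0⟩
      rw [h0] at h1
      exact absurd h1 (by decide)
    have hsum := Set.ncard_union_eq hd
    rw [hu, hcard, ← Nat.card_coe_set_eq] at hsum
    rw [two_mul, ← hsum]
    rfl
  · left
    rw [Set.ncard_eq_zero]
    ext x
    simp only [Set.mem_ofPred_eq, SetLike.mem_coe, Set.mem_empty_iff_false, iff_false, not_and]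
    exact fun hx h1 => h ⟨x, hx, h1⟩

/-! ### Intersections with lines and the maximal arc property. -/

section Lines

variable {K : Type*} [Field K] [Fintype K] [Algebra (ZMod 2) K]

/-- A line through the nucleus meets every conic of a closed set in exactly one point. -/
theorem ncard_line_through_nucleus (hK : Fintype.card K = 32) {C : Set (ConicForm K)}
    (hC : IsClosedConicSet C) (hfin : C.Finite) {l : Fin 3 → K} (hl : l ≠ 0) (hl2 : l 2 = 0) :
    {P ∈ arcOfConics C | Projectivization.orthogonal P (Projectivization.mk K l hl)}.ncard =
      C.ncard + 1 := by
  have := charP_two K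
  choose r hr using exists_sq_eq hK
  have hl01 : l 1 ≠ 0 ∨ l 0 ≠ 0 := by
    by_contra! h
    exact hl (by ext i; fin_cases i <;> simp [h, hl2])
  -- In characteristic 2 the points other than the nucleus on this line are `(l 1, l 0, z)`, and the
  -- conic fixes `z²`, hence `z`.
  let z (c : ConicForm K) : K := r ((c.α * l 1 ^ 2 + l 1 * l 0 + c.β * l 0 ^ 2) / c.lam)
  have hne (c : ConicForm K) : ![l 1, l 0, z c] ≠ 0 := by
    intro h
    have h0 := congrFun h 0
    have h1 := congrFun h 1
    simp at h0 h1
    tauto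
  have hz (c) (hc : c ∈ C) : c.lam * z c ^ 2 = c.α * l 1 ^ 2 + l 1 * l 0 + c.β * l 0 ^ 2 := by
    have := (hC.1 c hc).2
    rw [hr]
    field_simp
  have heval (c) (hc : c ∈ C) : c.eval ![l 1, l 0, z c] = 0 := by
    have := hz c hc
    simp only [ConicForm.eval, Matrix.cons_val]
    grind
  let f (c : ConicForm K) : PG2 K := Projectivization.mk K ![l 1, l 0, z c] (hne c)
  have hset : {P ∈ arcOfConics C | Projectivization.orthogonal P (Projectivization.mk K l hl)} =
      insert (nucleus K) (f '' C) := by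
    ext P
    induction P using Projectivization.ind with
    | h v hv =>
      rw [Set.mem_insert_iff]
      simp only [Set.mem_ofPred_eq, mk_mem_arcOfConics, Projectivization.orthogonal_mk, Set.mem_image,
        f, nucleus, Projectivization.mk_eq_mk_iff', dotProduct, Fin.sum_univ_three, hl2]
      constructor
      · rintro ⟨⟨h0, h1⟩ | ⟨c, hc, hcv⟩, hort⟩
        · left
          refine ⟨v 2, ?_⟩
          ext i
          fin_cases i <;> simp [h0, h1]
        · right
          refine ⟨c, hc, ?_⟩
          have hv01 := (hC.1 c hc).fst_or_snd_ne_zero hv hcv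
          obtain ⟨k, hk0, hk1⟩ : ∃ k, v 0 = k * l 1 ∧ v 1 = k * l 0 := by
            rcases hl01 with h | h
            · refine ⟨v 0 / l 1, by field_simp, ?_⟩
              field_simp
              grind
            · refine ⟨v 1 / l 0, ?_, by field_simp⟩
              field_simp
              grind
          have hk : k ≠ 0 := by
            rintro rfl
            simp [hk0, hk1] at hv01
          have hl0 := (hC.1 c hc).2
          have hk2 : v 2 = k * z c := by
            apply sq_injective
            apply mul_left_cancel₀ hl0
            have := hz c hc
            simp only [ConicForm.eval, hk0, hk1] at hcv
            grind
          refine ⟨k⁻¹, ?_⟩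
          ext i
          fin_cases i <;> simp [hk0, hk1, hk2, hk]
      · rintro (⟨a, rfl⟩ | ⟨c, hc, a, ha⟩)
        · simp
        · have ha0 : a ≠ 0 := by
            rintro rfl
            exact hne c (by rw [← ha, zero_smul])
          have h0 := congrFun ha 0
          have h1 := congrFun ha 1
          have h2 := congrFun ha 2
          simp only [Pi.smul_apply, smul_eq_mul, Matrix.cons_val] at h0 h1 h2
          refine ⟨Or.inr ⟨c, hc, ?_⟩, ?_⟩
          · have := heval c hc
            simp only [ConicForm.eval, Matrix.cons_val] at this ⊢
            rw [← h0, ← h1, ← h2] at this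
            have h3 : a ^ 2 * (c.α * v 0 ^ 2 + v 0 * v 1 + c.β * v 1 ^ 2 + c.lam * v 2 ^ 2) = 0 := by
              linear_combination this
            simpa [ha0] using h3
          · grind
  have hinj : Set.InjOn f C := by
    intro c hc c' hc' h
    simp only [f, Projectivization.mk_eq_mk_iff'] at h
    obtain ⟨a, ha⟩ := h
    have h0 := congrFun ha 0
    have h1 := congrFun ha 1
    have h2 := congrFun ha 2
    simp only [Pi.smul_apply, smul_eq_mul, Matrix.cons_val] at h0 h1 h2
    have ha1 : a = 1 := by
      rcases hl01 with h | h
      · exact (mul_eq_right₀ h).1 h0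
      · exact (mul_eq_right₀ h).1 h1
    rw [ha1, one_mul] at h2
    exact hC.eq_of_eval_eq_zero hK hc hc' (hne c) (heval c hc) (by rw [← h2]; exact heval c' hc')
  rw [hset, Set.ncard_insert_of_notMem _ (hfin.image f), hinj.ncard_image]
  rintro ⟨c, -, h⟩
  simp only [f, nucleus, Projectivization.mk_eq_mk_iff'] at h
  obtain ⟨a, ha⟩ := h
  have h0 := congrFun ha 0
  have h1 := congrFun ha 1
  simp at h0 h1
  tauto

/-- The line `z = u x + v y` meets a conic of Mathon's family in `0` or `2` points. -/
theorem ncard_line_conic (hK : Fintype.card K = 32) {c : ConicForm K} (hc : c.IsMathonConic)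
    {l : Fin 3 → K} (hl : l ≠ 0) (hl2 : l 2 = 1) :
    {P ∈ c.points | Projectivization.orthogonal P (Projectivization.mk K l hl)}.ncard =
      if Tr K (c.lam * c.β * l 0 ^ 2 + c.lam * c.α * l 1 ^ 2 + c.lam * l 0 * l 1) = 1
        then 2 else 0 := by
  have := charP_two K
  have key (v : Fin 3 → K) (h : v 0 * l 0 + v 1 * l 1 + v 2 * 1 = 0) :
      c.eval v = (c.α + c.lam * l 0 ^ 2) * v 0 ^ 2 + v 0 * v 1 +
        (c.β + c.lam * l 1 ^ 2) * v 1 ^ 2 := by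
    have : v 2 = l 0 * v 0 + l 1 * v 1 := by grind
    simp only [ConicForm.eval]
    grind
  split_ifs with h
  · have h1 := trace_line hK (l := c.lam) hc.1 (l 0) (l 1)
    rw [h] at h1
    obtain ⟨k, x₁, y₁, x₂, y₂, hk, hne, hfac⟩ := exists_factorization hK (h1.trans (by decide))
    have hv {x y x' y' z : K} (h : x * y' ≠ x' * y) : ![x, y, z] ≠ 0 := by
      intro h0
      have h1 := congrFun h0 0
      have h2 := congrFun h0 1
      simp at h1 h2
      simp [h1, h2] at h
    have hset : {P ∈ c.points | Projectivization.orthogonal P (Projectivization.mk K l hl)} =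
        {Projectivization.mk K ![x₁, y₁, l 0 * x₁ + l 1 * y₁] (hv hne),
          Projectivization.mk K ![x₂, y₂, l 0 * x₂ + l 1 * y₂] (hv hne.symm)} := by
      ext P
      induction P using Projectivization.ind with
      | h v hv =>
        simp only [Set.mem_ofPred_eq, ConicForm.mk_mem_points, Projectivization.orthogonal_mk,
          Set.mem_insert_iff, Set.mem_singleton_iff, Projectivization.mk_eq_mk_iff', dotProduct,
          Fin.sum_univ_three, hl2]
        have hmul {x y : K} (hxy : x ≠ 0 ∨ y ≠ 0) (ho : v 0 * l 0 + v 1 * l 1 + v 2 * 1 = 0)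
            (h : v 0 * y - x * v 1 = 0) : ∃ a : K, a • ![x, y, l 0 * x + l 1 * y] = v := by
          obtain ⟨a, h0, h1⟩ : ∃ a, a * x = v 0 ∧ a * y = v 1 := by
            rcases hxy with h' | h'
            · exact ⟨v 0 / x, by field_simp, by field_simp; grind⟩
            · exact ⟨v 1 / y, by field_simp; grind, by field_simp⟩
          refine ⟨a, ?_⟩
          ext i
          fin_cases i
          · simpa using h0
          · simpa using h1
          · simp only [Pi.smul_apply, smul_eq_mul]
            simp
            grind
        constructor
        · rintro ⟨hP, ho⟩
          have hP' := (key v ho).symm.trans hP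
          rw [hfac] at hP'
          rcases mul_eq_zero.1 hP' with h | h
          · left
            refine hmul ?_ ho ((mul_eq_zero.1 h).resolve_left hk)
            by_contra! h0
            simp [h0] at hne
          · right
            refine hmul ?_ ho h
            by_contra! h0
            simp [h0] at hne
        · intro h
          have : (∃ a x y, v 0 = a * x ∧ v 1 = a * y ∧ v 2 = a * (l 0 * x + l 1 * y) ∧
              (x * y₁ - x₁ * y) * (x * y₂ - x₂ * y) = 0) := by
            rcases h with ⟨a, rfl⟩ | ⟨a, rfl⟩
            · exact ⟨a, x₁, y₁, by simp, by simp, by simp, by ring⟩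
            · exact ⟨a, x₂, y₂, by simp, by simp, by simp, by ring⟩
          obtain ⟨a, x, y, h0, h1, h2, h3⟩ := this
          have ho : v 0 * l 0 + v 1 * l 1 + v 2 * 1 = 0 := by grind
          refine ⟨(key v ho).trans ?_, ho⟩
          rw [hfac, h0, h1]
          linear_combination k * a ^ 2 * h3
    rw [hset, Set.ncard_pair]
    intro h
    obtain ⟨a, ha⟩ := (Projectivization.mk_eq_mk_iff' ..).1 h
    have h0 := congrFun ha 0
    have h1 := congrFun ha 1
    simp only [Pi.smul_apply, smul_eq_mul, Matrix.cons_val] at h0 h1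
    exact hne (by rw [← h0, ← h1]; ring)
  · rw [Set.ncard_eq_zero]
    ext P
    induction P using Projectivization.ind with
    | h v hv =>
      simp only [Set.mem_ofPred_eq, ConicForm.mk_mem_points, Projectivization.orthogonal_mk,
        dotProduct, Fin.sum_univ_three, hl2, Set.mem_empty_iff_false, iff_false, not_and]
      intro hP ho
      refine h (hc.trace_eq_one hK (hc.fst_or_snd_ne_zero hv hP) ?_)
      have : ![v 0, v 1, l 0 * v 0 + l 1 * v 1] = v := by
        ext i
        fin_cases i
        · rfl
        · rfl
        · simp
          grind
      rw [this]
      exact hP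

/-- Mathon's theorem for the families of order `8`. -/
theorem isMaximalArc_cubicFamily (hK : Fintype.card K = 32) {A : AddSubgroup K}
    (hA : Nat.card A = 8) {p q : Fin 3 → K} (hC : IsClosedConicSet (cubicFamily A p q)) :
    IsMaximalArc 8 (arcOfConics (cubicFamily A p q)) := by
  have := charP_two K
  have : Finite (ConicForm K) := Finite.of_injective
    (fun c : ConicForm K => (c.α, c.β, c.lam)) fun c c' h => by
      simp only [Prod.mk.injEq] at h
      exact ConicForm.ext h.1 h.2.1 h.2.2
  refine ⟨⟨_, Set.mem_insert _ _⟩, fun h => ?_, fun l => ?_⟩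
  -- The arc is proper: if it contained `(1, 0, 0)`, some conic would have `α = 0`, against the
  -- trace condition.
  · have h1 : Projectivization.mk K ![1, 0, 0] (fun h => one_ne_zero (congrFun h 0)) ∈
        arcOfConics (cubicFamily A p q) := by rw [h]; trivial
    have h2 : Projectivization.mk K ![0, 1, 0] (fun h => one_ne_zero (congrFun h 1)) ∈
        arcOfConics (cubicFamily A p q) := by rw [h]; trivial
    rw [mk_mem_arcOfConics] at h1
    simp only [Matrix.cons_val, one_ne_zero, false_and, false_or, ConicForm.eval] at h1
    obtain ⟨c, hc, h1⟩ := h1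
    have := (hC.1 c hc).1
    have h3 : c.α = 0 := by simpa using h1
    rw [h3] at this
    simp at this
  · induction l using Projectivization.ind with
    | h l hl =>
      by_cases hl2 : l 2 = 0
      · right
        rw [ncard_line_through_nucleus hK hC (Set.toFinite _) hl hl2, ncard_cubicFamily, hA]
      · wlog h1 : l 2 = 1 generalizing l
        · have hl' : (l 2)⁻¹ • l ≠ 0 := by simpa [hl2] using hl
          have heq : Projectivization.mk K l hl = Projectivization.mk K ((l 2)⁻¹ • l) hl' :=
            ((Projectivization.mk_eq_mk_iff' ..).2 ⟨(l 2)⁻¹, rfl⟩).symm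
          rw [heq]
          exact this _ hl' (by simp [hl2]) (by simp [hl2])
        -- The conic with parameter `m` is secant to the line exactly when `L m = 1`.
        · let L : K →+ ZMod 2 := (Tr K : K →+ ZMod 2).comp
            ((AddMonoidHom.mulRight (l 0 ^ 2)).comp (additivePoly q) +
              (AddMonoidHom.mulRight (l 1 ^ 2)).comp (additivePoly p) +
              AddMonoidHom.mulRight (l 0 * l 1))
          have hL (m : K) : L m = Tr K ((cubicConic p q m).lam * (cubicConic p q m).β * l 0 ^ 2 +
              (cubicConic p q m).lam * (cubicConic p q m).α * l 1 ^ 2 +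
              (cubicConic p q m).lam * l 0 * l 1) := by
            simp only [L, AddMonoidHom.comp_apply, AddMonoidHom.add_apply,
              AddMonoidHom.mulRight_apply, additivePoly_apply, cubicConic, AddMonoidHom.coe_coe]
            congr 1
            ring
          have hset : {P ∈ arcOfConics (cubicFamily A p q) |
              Projectivization.orthogonal P (Projectivization.mk K l hl)} =
              ⋃ m ∈ {m ∈ (A : Set K) | L m = 1}, {P ∈ (cubicConic p q m).points |
                Projectivization.orthogonal P (Projectivization.mk K l hl)} := by
            ext P
            simp only [Set.mem_ofPred_eq, Set.mem_iUnion, arcOfConics, Set.mem_insert_iff, exists_prop,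
              SetLike.mem_coe]
            constructor
            · rintro ⟨hP | ⟨c, ⟨m, hm, hm0, rfl⟩, hP⟩, ho⟩
              · subst hP
                simp [nucleus, Projectivization.orthogonal_mk] at ho
                exact absurd ho hl2
              · refine ⟨m, ⟨hm, ?_⟩, hP, ho⟩
                by_contra hLm
                have hcard := ncard_line_conic hK (hC.1 _ ⟨m, hm, hm0, rfl⟩) hl h1
                rw [← hL, if_neg hLm, Set.ncard_eq_zero] at hcard
                exact (Set.ext_iff.1 hcard P).1 ⟨hP, ho⟩
            · rintro ⟨m, ⟨hm, hLm⟩, hP, ho⟩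
              refine ⟨Or.inr ⟨_, ⟨m, hm, ?_, rfl⟩, hP⟩, ho⟩
              rintro rfl
              simp at hLm
          have hm0 {m : K} (h : L m = 1) : m ≠ 0 := by
            rintro rfl
            simp at h
          rw [hset, (Set.toFinite _).ncard_biUnion (fun _ _ => Set.toFinite _),
            finsum_mem_eq_finite_toFinset_sum _ (Set.toFinite _), Finset.sum_congr rfl (g := fun _ => 2),
            Finset.sum_const, smul_eq_mul, ← Set.ncard_eq_toFinset_card]
          -- None or four of the conics are met, each in two points.
          · have := ncard_fiber_one A L
            omega
          · intro m hm
            obtain ⟨hm, hLm⟩ := (Set.Finite.mem_toFinset _).1 hm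
            rw [ncard_line_conic hK (hC.1 _ ⟨m, hm, hm0 hLm, rfl⟩) hl h1, ← hL, if_pos hLm]
          · rintro m ⟨hm, hLm⟩ m' ⟨hm', hLm'⟩ hne
            rw [Function.onFun, Set.disjoint_left]
            intro P
            induction P using Projectivization.ind with
            | h v hv =>
              rintro ⟨hP, -⟩ ⟨hP', -⟩
              rw [ConicForm.mk_mem_points] at hP hP'
              exact hne (cubicConic_injective p q (hC.eq_of_eval_eq_zero hK ⟨m, hm, hm0 hLm, rfl⟩
                ⟨m', hm', hm0 hLm', rfl⟩ hv hP hP'))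

end Lines

/-! ### Semilinear maps acting on lines and on conics. -/

section Collineations

variable {K : Type*} [Field K]

theorem semilinear_apply {σ : K ≃+* K} (f : (Fin 3 → K) →ₛₗ[(σ : K →+* K)] (Fin 3 → K))
    (v : Fin 3 → K) (i : Fin 3) :
    f v i = σ (v 0) * f ![1, 0, 0] i + σ (v 1) * f ![0, 1, 0] i + σ (v 2) * f ![0, 0, 1] i := by
  have hv : v = v 0 • ![1, 0, 0] + v 1 • ![0, 1, 0] + v 2 • ![0, 0, 1] := by
    ext i
    fin_cases i <;> simp
  conv_lhs => rw [hv]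
  simp only [map_add, LinearMap.map_smulₛₗ]
  simp

theorem semilinear_projectivization_injective {σ : K ≃+* K}
    (f : (Fin 3 → K) →ₛₗ[(σ : K →+* K)] (Fin 3 → K)) (hf : Function.Injective f) :
    Function.Injective (Projectivization.map f hf) := by
  have := RingHomInvPair.of_ringEquiv σ
  exact Projectivization.map_injective (τ := (σ.symm : K →+* K)) f hf

theorem IsMaximalArc.of_iso {d : ℕ} {S T : Set (PG2 K)} (hS : IsMaximalArc d S) (h : Iso S T) :
    IsMaximalArc d T := by
  obtain ⟨g, ⟨σ, f, hf, rfl⟩, rfl⟩ := h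
  have hinj := semilinear_projectivization_injective f hf.injective
  refine ⟨hS.1.image _, fun h => hS.2.1 ?_, fun l => ?_⟩
  · refine Set.eq_univ_of_forall fun P => ?_
    obtain ⟨Q, hQ, hQP⟩ := (Set.ext_iff.1 h (Projectivization.map f hf.injective P)).2 trivial
    exact hinj hQP ▸ hQ
  · induction l using Projectivization.ind with
    | h u hu =>
      let e : Fin 3 → Fin 3 → K := ![![1, 0, 0], ![0, 1, 0], ![0, 0, 1]]
      -- The transpose of `f` pulls the line `u` back to a line, so intersection numbers are
      -- preserved.
      let u' : Fin 3 → K := fun i => σ.symm (f (e i) ⬝ᵥ u)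
      have hdot (v : Fin 3 → K) : f v ⬝ᵥ u = σ (v ⬝ᵥ u') := by
        simp only [dotProduct, Fin.sum_univ_three, map_add, map_mul, u', RingEquiv.apply_symm_apply,
          semilinear_apply f v, e, Matrix.cons_val]
        ring
      have hu' : u' ≠ 0 := by
        intro h0
        apply hu
        ext i
        obtain ⟨v, hv⟩ := hf.surjective (Pi.single i 1)
        have := hdot v
        rw [hv, h0] at this
        simpa using this
      have hset : {P ∈ Projectivization.map f hf.injective '' S |
          Projectivization.orthogonal P (Projectivization.mk K u hu)} =
          Projectivization.map f hf.injective ''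
            {P ∈ S | Projectivization.orthogonal P (Projectivization.mk K u' hu')} := by
        have hort (P : PG2 K) : Projectivization.orthogonal (Projectivization.map f hf.injective P)
            (Projectivization.mk K u hu) ↔
            Projectivization.orthogonal P (Projectivization.mk K u' hu') := by
          induction P using Projectivization.ind with
          | h v hv =>
            rw [Projectivization.map_mk, Projectivization.orthogonal_mk,
              Projectivization.orthogonal_mk, hdot, map_eq_zero_iff σ σ.injective]
        ext P
        constructor
        · rintro ⟨⟨Q, hQ, rfl⟩, ho⟩
          exact ⟨Q, ⟨hQ, (hort Q).1 ho⟩, rfl⟩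
        · rintro ⟨Q, ⟨hQ, ho⟩, rfl⟩
          exact ⟨⟨Q, hQ, rfl⟩, (hort Q).2 ho⟩
      rw [hset, Set.ncard_image_of_injective _ hinj]
      exact hS.2.2 _

/-- The arcs of two sets of conics are isomorphic if a substitution
`x ↦ a x + b y`, `y ↦ c x + d y`, `z ↦ e x + f y + g z` after a field automorphism matches the
conics. -/
theorem iso_arcOfConics [Finite K] [CharP K 2] {C C' : Set (ConicForm K)} (σ : K ≃+* K)
    {a b c d e f g : K} (hδ : a * d + b * c ≠ 0) (hg : g ≠ 0) (R : ConicForm K → ConicForm K → Prop)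
    (hR : ∀ D D', R D D' → D'.lam * g ^ 2 = (a * d + b * c) * σ D.lam ∧
      D'.α * a ^ 2 + a * c + D'.β * c ^ 2 + D'.lam * e ^ 2 = (a * d + b * c) * σ D.α ∧
      D'.α * b ^ 2 + b * d + D'.β * d ^ 2 + D'.lam * f ^ 2 = (a * d + b * c) * σ D.β)
    (h : ∀ D ∈ C, ∃ D' ∈ C', R D D') (h' : ∀ D' ∈ C', ∃ D ∈ C, R D D') :
    Iso (arcOfConics C) (arcOfConics C') := by
  let F : (Fin 3 → K) →ₛₗ[(σ : K →+* K)] (Fin 3 → K) :=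
    ⟨⟨fun v => ![a * σ (v 0) + b * σ (v 1), c * σ (v 0) + d * σ (v 1),
      e * σ (v 0) + f * σ (v 1) + g * σ (v 2)], fun v w => by
        ext i
        fin_cases i <;> simp <;> ring⟩, fun k v => by
        ext i
        fin_cases i <;> simp <;> ring⟩
  have hF0 (v) : F v 0 = a * σ (v 0) + b * σ (v 1) := rfl
  have hF1 (v) : F v 1 = c * σ (v 0) + d * σ (v 1) := rfl
  have hF2 (v) : F v 2 = e * σ (v 0) + f * σ (v 1) + g * σ (v 2) := rfl
  have h2 : (2 : K) = 0 := CharTwo.two_eq_zero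
  have h01 (v) : (F v 0 = 0 ∧ F v 1 = 0) ↔ (v 0 = 0 ∧ v 1 = 0) := by
    rw [hF0, hF1]
    constructor
    · rintro ⟨h0, h1⟩
      have hx : (a * d + b * c) * σ (v 0) = 0 := by
        linear_combination d * h0 + b * h1 - b * d * σ (v 1) * h2
      have hy : (a * d + b * c) * σ (v 1) = 0 := by
        linear_combination c * h0 + a * h1 - a * c * σ (v 0) * h2
      simpa [hδ] using And.intro hx hy
    · rintro ⟨h0, h1⟩
      simp [h0, h1]
  have hinj : Function.Injective F := by
    rw [injective_iff_map_eq_zero]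
    intro v hv
    obtain ⟨h0, h1⟩ := (h01 v).1 ⟨congrFun hv 0, congrFun hv 1⟩
    have h2 := congrFun hv 2
    rw [hF2] at h2
    have h2 : v 2 = 0 := by simpa [h0, h1, hg] using h2
    ext i
    fin_cases i <;> assumption
  have hbij : Function.Bijective F := Finite.injective_iff_bijective.1 hinj
  -- After the substitution the `xy`-coefficient of `D'` is `a d + b c`, which fixes the factor; the
  -- equations in `hR` are the three square coefficients, and the other mixed terms vanish.
  have heval (D D') (hD : R D D') (v) : D'.eval (F v) = (a * d + b * c) * σ (D.eval v) := by
    obtain ⟨h1, h2, h3⟩ := hR D D' hD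
    simp only [ConicForm.eval, hF0, hF1, hF2, map_add, map_mul, map_pow]
    grind
  have hmem (v) (hv : v ≠ 0) (hv' : F v ≠ 0) : Projectivization.mk K (F v) hv' ∈ arcOfConics C' ↔
      Projectivization.mk K v hv ∈ arcOfConics C := by
    rw [mk_mem_arcOfConics, mk_mem_arcOfConics, h01]
    refine or_congr_right ⟨?_, ?_⟩
    · rintro ⟨D', hD', h0⟩
      obtain ⟨D, hD, hDD⟩ := h' D' hD'
      rw [heval D D' hDD] at h0
      exact ⟨D, hD, by simpa [hδ] using h0⟩
    · rintro ⟨D, hD, h0⟩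
      obtain ⟨D', hD', hDD⟩ := h D hD
      exact ⟨D', hD', by rw [heval D D' hDD, h0, map_zero, mul_zero]⟩
  refine ⟨_, ⟨σ, F, hbij, rfl⟩, ?_⟩
  ext P
  induction P using Projectivization.ind with
  | h w hw =>
    obtain ⟨v, rfl⟩ := hbij.surjective w
    have hv : v ≠ 0 := by
      rintro rfl
      exact hw (map_zero F)
    rw [hmem v hv hw, ← Projectivization.map_mk F hinj v hv,
      (semilinear_projectivization_injective F hinj).mem_set_image]

end Collineations

/-! ### Five points determine a conic; collineations match conics. -/

section Bezout

variable {K : Type*} [Field K]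

/-- The second alternative counts infinity as a fifth root, which is needed for the point `(1, 0,
A)` of a parametrized conic. -/
theorem quartic_coeff_eq_zero {a₀ a₁ a₂ a₃ a₄ : K} (S : Finset K)
    (hS : ∀ s ∈ S, a₀ + a₁ * s + a₂ * s ^ 2 + a₃ * s ^ 3 + a₄ * s ^ 4 = 0)
    (hcard : 5 ≤ S.card ∨ 4 ≤ S.card ∧ a₄ = 0) :
    a₀ = 0 ∧ a₁ = 0 ∧ a₂ = 0 ∧ a₃ = 0 ∧ a₄ = 0 := by
  open Polynomial in
  have hp : (C a₀ + C a₁ * X + C a₂ * X ^ 2 + C a₃ * X ^ 3 + C a₄ * X ^ 4 : K[X]) = 0 := by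
    refine Polynomial.eq_zero_of_natDegree_lt_card_of_eval_eq_zero' _ S
      (fun s hs => by simpa using hS s hs) ?_
    rcases hcard with h | ⟨h, h4⟩
    · exact lt_of_le_of_lt (by compute_degree) h
    · rw [h4]
      refine lt_of_le_of_lt (b := 3) ?_ h
      simp only [map_zero, zero_mul, add_zero]
      compute_degree
  have hc (n : ℕ) := congrArg (Polynomial.coeff · n) hp
  have h0 := hc 0
  have h1 := hc 1
  have h2 := hc 2
  have h3 := hc 3
  have h4 := hc 4
  simp [Polynomial.coeff_X, Polynomial.coeff_C] at h0 h1 h2 h3 h4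
  exact ⟨h0, h1, h2, h3, h4⟩

/-- A quadratic form that vanishes in five points of the conic `α x² + x y + β y² + l z² = 0`
is a multiple of its equation. The points are `(s², 1, A s² + B s + C)` and `(1, 0, A)`. -/
theorem quadratic_proportional [CharP K 2] {α β l A B C : K} (hl : l ≠ 0) (hA : l * A ^ 2 = α)
    (hB : l * B ^ 2 = 1) (hC : l * C ^ 2 = β) {r₁ r₂ r₃ r₄ r₅ r₆ : K} (S : Finset (Option K))
    (hS : 5 ≤ S.card) (h : ∀ s, some s ∈ S → r₁ * s ^ 4 + r₂ + r₃ * (A * s ^ 2 + B * s + C) ^ 2 +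
      r₄ * s ^ 2 + r₅ * s ^ 2 * (A * s ^ 2 + B * s + C) + r₆ * (A * s ^ 2 + B * s + C) = 0)
    (h' : none ∈ S → r₁ + r₃ * A ^ 2 + r₅ * A = 0) :
    r₁ = r₄ * α ∧ r₂ = r₄ * β ∧ r₃ = r₄ * l ∧ r₅ = 0 ∧ r₆ = 0 := by
  have hB0 : B ≠ 0 := by
    rintro rfl
    simp at hB
  -- These are the coefficients of the quartic in `s` obtained by restricting the form to the
  -- parametrized conic.
  have key := quartic_coeff_eq_zero (a₀ := r₂ + r₃ * C ^ 2 + r₆ * C) (a₁ := r₆ * B)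
    (a₂ := r₄ + r₃ * B ^ 2 + r₅ * C + r₆ * A) (a₃ := r₅ * B) (a₄ := r₁ + r₃ * A ^ 2 + r₅ * A)
    S.eraseNone (fun s hs => by
      have := h s (Finset.mem_eraseNone.1 hs)
      grind) (by
      by_cases hn : none ∈ S
      · right
        refine ⟨?_, h' hn⟩
        have := Finset.card_eraseNone_of_mem hn
        omega
      · left
        have := Finset.card_eraseNone_of_not_mem hn
        omega)
  obtain ⟨h0, h1, h2, h3, h4⟩ := key
  have h5 : r₅ = 0 := by simpa [hB0] using h3
  have h6 : r₆ = 0 := by simpa [hB0] using h1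
  subst h5 h6
  have h3' : r₃ = r₄ * l := by grind
  refine ⟨?_, ?_, h3', rfl, rfl⟩ <;> grind

/-- A collineation between the arcs of two sets of conics, of which the second has at most seven
members, maps conics to conics. -/
theorem Iso.exists_matching [Fintype K] [Algebra (ZMod 2) K] (hK : Fintype.card K = 32)
    {C C' : Set (ConicForm K)} (hC : ∀ c ∈ C, c.lam ≠ 0) (hC' : ∀ c ∈ C', c.lam ≠ 0)
    (hfin : C'.Finite) (hcard : C'.ncard ≤ 7) (h : Iso (arcOfConics C) (arcOfConics C')) :
    ∃ (σ : K ≃+* K) (a b c d e f g : K), ∀ D ∈ C, a * d + b * c ≠ 0 ∧ g ≠ 0 ∧ ∃ D' ∈ C',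
      D'.lam * g ^ 2 = (a * d + b * c) * σ D.lam ∧
      D'.α * a ^ 2 + a * c + D'.β * c ^ 2 + D'.lam * e ^ 2 = (a * d + b * c) * σ D.α ∧
      D'.α * b ^ 2 + b * d + D'.β * d ^ 2 + D'.lam * f ^ 2 = (a * d + b * c) * σ D.β := by
  classical
  have := charP_two K
  obtain ⟨_, ⟨σ, F, hF, rfl⟩, himg⟩ := h
  obtain ⟨a, ha⟩ : ∃ a, a = F ![1, 0, 0] 0 := ⟨_, rfl⟩
  obtain ⟨b, hb⟩ : ∃ b, b = F ![0, 1, 0] 0 := ⟨_, rfl⟩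
  obtain ⟨p, hp⟩ : ∃ p, p = F ![0, 0, 1] 0 := ⟨_, rfl⟩
  obtain ⟨c, hc⟩ : ∃ c, c = F ![1, 0, 0] 1 := ⟨_, rfl⟩
  obtain ⟨d, hd⟩ : ∃ d, d = F ![0, 1, 0] 1 := ⟨_, rfl⟩
  obtain ⟨q, hq⟩ : ∃ q, q = F ![0, 0, 1] 1 := ⟨_, rfl⟩
  obtain ⟨e, he⟩ : ∃ e, e = F ![1, 0, 0] 2 := ⟨_, rfl⟩
  obtain ⟨f, hf⟩ : ∃ f, f = F ![0, 1, 0] 2 := ⟨_, rfl⟩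
  obtain ⟨g, hg⟩ : ∃ g, g = F ![0, 0, 1] 2 := ⟨_, rfl⟩
  have hF0 (v) : F v 0 = σ (v 0) * a + σ (v 1) * b + σ (v 2) * p := by
    rw [ha, hb, hp]
    exact semilinear_apply F v 0
  have hF1 (v) : F v 1 = σ (v 0) * c + σ (v 1) * d + σ (v 2) * q := by
    rw [hc, hd, hq]
    exact semilinear_apply F v 1
  have hF2 (v) : F v 2 = σ (v 0) * e + σ (v 1) * f + σ (v 2) * g := by
    rw [he, hf, hg]
    exact semilinear_apply F v 2
  refine ⟨σ, a, b, c, d, e, f, g, fun D hD => ?_⟩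
  have hl := hC D hD
  obtain ⟨A, hA⟩ := exists_sq_eq hK (D.α / D.lam)
  obtain ⟨B, hB⟩ := exists_sq_eq hK (1 / D.lam)
  obtain ⟨G, hG⟩ := exists_sq_eq hK (D.β / D.lam)
  have hA' : D.lam * A ^ 2 = D.α := by rw [hA]; field_simp
  have hB' : D.lam * B ^ 2 = 1 := by rw [hB]; field_simp
  have hG' : D.lam * G ^ 2 = D.β := by rw [hG]; field_simp
  let par (s : Option K) : Fin 3 → K :=
    s.elim ![1, 0, A] fun s => ![s ^ 2, 1, A * s ^ 2 + B * s + G]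
  have hpar0 (s) : par s ≠ 0 := by
    intro h
    cases s with
    | none => exact one_ne_zero (congrFun h 0)
    | some s => exact one_ne_zero (congrFun h 1)
  have hpar (s) : D.eval (par s) = 0 := by
    cases s with
    | none => simp [par, ConicForm.eval, hA', CharTwo.add_self_eq_zero]
    | some s =>
      simp only [par, ConicForm.eval, Option.elim, Matrix.cons_val]
      grind
  have hparinj {s t} {k : K} (h : k • par s = par t) : s = t := by
    cases s <;> cases t
    · rfl
    · simpa [par] using congrFun h 1
    · have h0 := congrFun h 0
      have h1 := congrFun h 1
      simp [par] at h0 h1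
      simp [h1] at h0
    · have h0 := congrFun h 0
      have h1 := congrFun h 1
      simp [par] at h0 h1
      rw [h1, one_mul] at h0
      rw [sq_injective h0]
  have hmem (s) : (F (par s) 0 = 0 ∧ F (par s) 1 = 0) ∨ ∃ D' ∈ C', D'.eval (F (par s)) = 0 := by
    have hv : F (par s) ≠ 0 := fun h => hpar0 s (hF.injective (h.trans (map_zero F).symm))
    rw [← mk_mem_arcOfConics C' _ hv, ← himg]
    exact ⟨Projectivization.mk K (par s) (hpar0 s),
      (mk_mem_arcOfConics C _ _).2 (Or.inr ⟨D, hD, hpar s⟩), Projectivization.map_mk ..⟩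
  -- Pigeonhole: at most one of the 33 points goes to the nucleus, and `1 + 7 * 4 = 29 < 33`.
  obtain ⟨D', hD', hS⟩ : ∃ D' ∈ C',
      5 ≤ (Finset.univ.filter fun s => D'.eval (F (par s)) = 0).card := by
    by_contra! hlt
    have hsub : (Finset.univ : Finset (Option K)) ⊆
        (Finset.univ.filter fun s => F (par s) 0 = 0 ∧ F (par s) 1 = 0) ∪
          hfin.toFinset.biUnion fun D' => Finset.univ.filter fun s => D'.eval (F (par s)) = 0 := by
      intro s _
      simpa using hmem s
    have hone : (Finset.univ.filter fun s => F (par s) 0 = 0 ∧ F (par s) 1 = 0).card ≤ 1 := by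
      rw [Finset.card_le_one]
      intro s hs t ht
      simp only [Finset.mem_filter, Finset.mem_univ, true_and] at hs ht
      have hs2 : F (par s) 2 ≠ 0 := by
        intro h2
        refine hpar0 s (hF.injective ?_)
        rw [map_zero]
        ext i
        fin_cases i <;> simp [hs, h2]
      refine hparinj (k := σ.symm (F (par t) 2 / F (par s) 2)) (hF.injective ?_)
      rw [LinearMap.map_smulₛₗ]
      ext i
      fin_cases i <;> simp [hs, ht, hs2]
    have h1 := Finset.card_le_card hsub
    have h2 := Finset.card_union_le
      (Finset.univ.filter fun s => F (par s) 0 = 0 ∧ F (par s) 1 = 0)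
      (hfin.toFinset.biUnion fun D' => Finset.univ.filter fun s => D'.eval (F (par s)) = 0)
    have h3 := Finset.card_biUnion_le_card_mul hfin.toFinset
      (fun D' => Finset.univ.filter fun s => D'.eval (F (par s)) = 0) 4 (fun D' hD' => by
        have := hlt D' (hfin.mem_toFinset.1 hD')
        omega)
    rw [Set.ncard_eq_toFinset_card C' hfin] at hcard
    rw [Finset.card_univ, Fintype.card_option, hK] at h1
    omega
  have hσl : σ D.lam ≠ 0 := (map_ne_zero σ).2 hl
  -- The `rᵢ` are the coefficients of `D'` composed with the matrix of `F`; the automorphism is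
  -- moved to `D` and to the parameter `s`.
  have key := quadratic_proportional hσl (α := σ D.α) (β := σ D.β) (A := σ A) (B := σ B)
    (C := σ G) (by rw [← map_pow, ← map_mul, hA']) (by rw [← map_pow, ← map_mul, hB', map_one])
    (by rw [← map_pow, ← map_mul, hG'])
    (r₁ := D'.α * a ^ 2 + a * c + D'.β * c ^ 2 + D'.lam * e ^ 2)
    (r₂ := D'.α * b ^ 2 + b * d + D'.β * d ^ 2 + D'.lam * f ^ 2)
    (r₃ := D'.α * p ^ 2 + p * q + D'.β * q ^ 2 + D'.lam * g ^ 2)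
    (r₄ := a * d + b * c) (r₅ := a * q + p * c) (r₆ := b * q + p * d)
    ((Finset.univ.filter fun s => D'.eval (F (par s)) = 0).map σ.toEquiv.optionCongr.toEmbedding)
    (by rw [Finset.card_map]; exact hS) (fun s hs => by
      rw [Finset.mem_map] at hs
      obtain ⟨t, ht, hts⟩ := hs
      cases t with
      | none => simp at hts
      | some t =>
        have hts : σ t = s := by simpa using hts
        have ht := (Finset.mem_filter.1 ht).2
        simp only [ConicForm.eval, hF0, hF1, hF2, par, Option.elim, Matrix.cons_val, map_add,
          map_mul, map_pow, hts, map_one] at ht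
        grind) (fun hs => by
      rw [Finset.mem_map] at hs
      obtain ⟨t, ht, hts⟩ := hs
      cases t with
      | some t => simp at hts
      | none =>
        have ht := (Finset.mem_filter.1 ht).2
        simp only [ConicForm.eval, hF0, hF1, hF2, par, Option.elim, Matrix.cons_val, map_one,
          map_zero] at ht
        grind)
  obtain ⟨h1, h2, h3, h5, h6⟩ := key
  -- Otherwise `D'` would vanish on the whole image of `F`, including `(0, 0, 1)`, where its value
  -- is `D'.lam`.
  have hδ : a * d + b * c ≠ 0 := by
    intro h0
    obtain ⟨v, hv⟩ := hF.surjective ![0, 0, 1]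
    have h4 : D'.eval (F v) = 0 := by
      simp only [ConicForm.eval, hF0, hF1, hF2]
      grind
    rw [hv] at h4
    simp only [ConicForm.eval, Matrix.cons_val] at h4
    exact hC' D' hD' (by simpa using h4)
  have htwo : (2 : K) = 0 := CharTwo.two_eq_zero
  -- The vanishing mixed coefficients `r₅`, `r₆` form a nonsingular linear system for `p`, `q`; thus
  -- `F` fixes the nucleus.
  have hp0 : p = 0 := by
    have : (a * d + b * c) * p = 0 := by
      linear_combination a * h6 + b * h5 - a * b * q * htwo
    simpa [hδ] using this
  have hq0 : q = 0 := by
    have : (a * d + b * c) * q = 0 := by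
      linear_combination d * h5 + c * h6 - p * c * d * htwo
    simpa [hδ] using this
  subst hp0 hq0
  have h3' : D'.lam * g ^ 2 = (a * d + b * c) * σ D.lam := by
    rw [← h3]
    ring
  refine ⟨hδ, ?_, D', hD', h3', h1, h2⟩
  rintro rfl
  simp [hδ, hl] at h3'

end Bezout

/-! ### Closed sets of seven conics as cubic families. -/

section Families

variable {K : Type*} [Field K]

/-- After multiplication by `l` this is a quartic with all eight elements of `A` as roots, so the
coefficients of a family are determined by its values on `A`. -/
theorem cubic_coeff_eq_zero {A : AddSubgroup K} [Finite K] (hA : Nat.card A = 8) {r₀ r₁ r₂ : K}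
    (h : ∀ l ∈ A, l ≠ 0 → r₀ + r₁ * l + r₂ * l ^ 3 = 0) : r₀ = 0 ∧ r₁ = 0 ∧ r₂ = 0 := by
  have hcard : 5 ≤ (Set.toFinite (A : Set K)).toFinset.card := by
    rw [← Set.ncard_eq_toFinset_card, ← Nat.card_coe_set_eq]
    exact le_trans (by norm_num) hA.ge
  have key := quartic_coeff_eq_zero (a₀ := 0) (a₁ := r₀) (a₂ := r₁) (a₃ := 0) (a₄ := r₂)
    (Set.toFinite (A : Set K)).toFinset (fun l hl => by
      have hl : l ∈ A := by simpa using hl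
      by_cases h0 : l = 0
      · simp [h0]
      · linear_combination l * h l hl h0) (Or.inl hcard)
  tauto

/-- `K³` and `Hom(A, K)` both have three times the dimension of `K` over GF(2), and restriction to
`A` is injective by `cubic_coeff_eq_zero`, hence surjective. -/
theorem exists_additivePoly_eq [Fintype K] [CharP K 2] [Algebra (ZMod 2) K] (A : AddSubgroup K)
    (hA : Nat.card A = 8) (P : A →+ K) : ∃ p : Fin 3 → K, ∀ l : A, additivePoly p l = P l := by
  let A' : Submodule (ZMod 2) K := AddSubgroup.toZModSubmodule 2 A
  let Φ' : (Fin 3 → K) →+ (A' →ₗ[ZMod 2] K) :=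
    { toFun := fun p => AddMonoidHom.toZModLinearMap 2 ((additivePoly p).comp A.subtype)
      map_zero' := by
        ext l
        change 0 * _ + 0 * _ + 0 * _ = (0 : K)
        ring
      map_add' := fun p q => by
        ext l
        change (p 0 + q 0) * _ + (p 1 + q 1) * _ + (p 2 + q 2) * _ =
          (p 0 * _ + p 1 * _ + p 2 * _) + (q 0 * _ + q 1 * _ + q 2 * _)
        ring }
  let Φ : (Fin 3 → K) →ₗ[ZMod 2] (A' →ₗ[ZMod 2] K) := AddMonoidHom.toZModLinearMap 2 Φ'
  have hΦ (p : Fin 3 → K) (l : A) : Φ p l = p 0 * (l : K) + p 1 * (l : K) ^ 2 + p 2 * (l : K) ^ 4 :=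
    rfl
  have hinj : Function.Injective Φ := by
    rw [injective_iff_map_eq_zero]
    intro p hp
    have := cubic_coeff_eq_zero hA (r₀ := p 0) (r₁ := p 1) (r₂ := p 2) (fun l hl h0 => by
      have h1 := hΦ p ⟨l, hl⟩
      rw [hp] at h1
      have h2 : l * (p 0 + p 1 * l + p 2 * l ^ 3) = 0 := by
        have h1' : 0 = p 0 * l + p 1 * l ^ 2 + p 2 * l ^ 4 := h1
        linear_combination -h1'
      exact (mul_eq_zero.1 h2).resolve_left h0)
    ext i
    fin_cases i
    exacts [this.1, this.2.1, this.2.2]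
  have hrank : Module.finrank (ZMod 2) (Fin 3 → K) = Module.finrank (ZMod 2) (A' →ₗ[ZMod 2] K) := by
    have h3 : Module.finrank (ZMod 2) A' = 3 := by
      have h := Module.natCard_eq_pow_finrank (K := ZMod 2) (V := A')
      rw [Nat.card_zmod, show Nat.card A' = 2 ^ 3 from hA] at h
      exact (Nat.pow_right_injective le_rfl h).symm
    rw [Module.finrank_linearMap, h3, Module.finrank_pi_fintype]
    simp
  have hsurj := (LinearMap.injective_iff_surjective_of_finrank_eq_finrank hrank).1 hinj
  obtain ⟨p, hp⟩ := hsurj (AddMonoidHom.toZModLinearMap 2 P : A' →ₗ[ZMod 2] K)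
  exact ⟨p, fun l => congrFun (congrArg DFunLike.coe hp) l⟩

/-- Composition adds the values of `lam`, `α * lam` and `β * lam`. So `lam` ranges over a group
without `0`, and the other two are additive functions on it, to be interpolated. -/
theorem IsClosedConicSet.exists_eq_cubicFamily [Fintype K] [Algebra (ZMod 2) K]
    {C : Set (ConicForm K)} (hC : IsClosedConicSet C) (hcard : C.ncard = 7) :
    ∃ (A : AddSubgroup K) (p q : Fin 3 → K), Nat.card A = 8 ∧ C = cubicFamily A p q := by
  have := charP_two K
  have hCfin : C.Finite := Set.finite_of_ncard_ne_zero (by omega)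
  have huniq {c c'} (hc : c ∈ C) (hc' : c' ∈ C) (h : c.lam = c'.lam) : c = c' := by
    by_contra hne
    exact (hC.2 c hc c' hc' hne).1 h
  let A : AddSubgroup K :=
    { carrier := insert 0 (ConicForm.lam '' C)
      zero_mem' := Set.mem_insert _ _
      add_mem' := by
        rintro _ _ (rfl | ⟨c, hc, rfl⟩) (rfl | ⟨c', hc', rfl⟩)
        · simp
        · rw [zero_add]
          exact Or.inr ⟨c', hc', rfl⟩
        · rw [add_zero]
          exact Or.inr ⟨c, hc, rfl⟩
        · by_cases h : c = c'
          · left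
            rw [h, CharTwo.add_self_eq_zero]
          · exact Or.inr ⟨_, (hC.2 c hc c' hc' h).2, rfl⟩
      neg_mem' := by
        intro x hx
        rwa [CharTwo.neg_eq] }
  have hmem (l : K) : l ∈ A ↔ l = 0 ∨ ∃ c ∈ C, c.lam = l := Iff.rfl
  have hAcard : Nat.card A = 8 := by
    have h1 : (insert 0 (ConicForm.lam '' C)).ncard = 8 := by
      rw [Set.ncard_insert_of_notMem, Set.InjOn.ncard_image, hcard]
      · exact fun c hc c' hc' h => huniq hc hc' h
      · rintro ⟨c, hc, h⟩
        exact (hC.1 c hc).2 h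
    rw [← h1, ← Nat.card_coe_set_eq]
    rfl
  have : Nonempty (ConicForm K) := ⟨⟨0, 0, 0⟩⟩
  choose! t ht htl using fun (l : K) (hl : l ∈ A ∧ l ≠ 0) => ((hmem l).1 hl.1).resolve_left hl.2
  have hadd (coef : ConicForm K → K) (hcoef : ∀ c ∈ C, ∀ c' ∈ C, c ≠ c' →
      coef (c.comp c') * (c.comp c').lam = coef c * c.lam + coef c' * c'.lam) :
      ∃ p : Fin 3 → K, ∀ l (_ : l ∈ A), l ≠ 0 → p 0 + p 1 * l + p 2 * l ^ 3 = coef (t l) := by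
    classical
    let P : A →+ K :=
      { toFun := fun l => if (l : K) = 0 then 0 else coef (t l) * l
        map_zero' := if_pos rfl
        map_add' := by
          rintro ⟨x, hx⟩ ⟨y, hy⟩
          simp only [AddMemClass.mk_add_mk]
          by_cases hx0 : x = 0
          · simp [hx0]
          by_cases hy0 : y = 0
          · simp [hy0]
          rw [if_neg hx0, if_neg hy0]
          by_cases hxy : x = y
          · simp [hxy, CharTwo.add_self_eq_zero]
          have hxy0 : x + y ≠ 0 := by grind
          rw [if_neg hxy0]
          have hne : t x ≠ t y := fun h => hxy (by
            rw [← htl x ⟨hx, hx0⟩, ← htl y ⟨hy, hy0⟩, h])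
          have h1 := hcoef _ (ht x ⟨hx, hx0⟩) _ (ht y ⟨hy, hy0⟩) hne
          have h2 : (t x).comp (t y) = t (x + y) := by
            refine huniq (hC.2 _ (ht x ⟨hx, hx0⟩) _ (ht y ⟨hy, hy0⟩) hne).2
              (ht _ ⟨A.add_mem hx hy, hxy0⟩) ?_
            rw [htl _ ⟨A.add_mem hx hy, hxy0⟩]
            simp only [ConicForm.comp, htl x ⟨hx, hx0⟩, htl y ⟨hy, hy0⟩]
          rwa [h2, htl _ ⟨A.add_mem hx hy, hxy0⟩, htl x ⟨hx, hx0⟩, htl y ⟨hy, hy0⟩] at h1 }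
    obtain ⟨p, hp⟩ := exists_additivePoly_eq A hAcard P
    refine ⟨p, fun l hl h0 => ?_⟩
    have h1 : p 0 * l + p 1 * l ^ 2 + p 2 * l ^ 4 = if l = 0 then 0 else coef (t l) * l :=
      hp ⟨l, hl⟩
    rw [if_neg h0] at h1
    apply mul_right_cancel₀ h0
    linear_combination h1
  have hcomp0 {c c'} (hc : c ∈ C) (hc' : c' ∈ C) (hne : c ≠ c') : c.lam + c'.lam ≠ 0 := by
    have := (hC.2 c hc c' hc' hne).1
    grind
  obtain ⟨p, hp⟩ := hadd ConicForm.α fun c hc c' hc' hne => by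
    have := hcomp0 hc hc' hne
    simp only [ConicForm.comp]
    field_simp
  obtain ⟨q, hq⟩ := hadd ConicForm.β fun c hc c' hc' hne => by
    have := hcomp0 hc hc' hne
    simp only [ConicForm.comp]
    field_simp
  have ht' (l) (hl : l ∈ A) (h0 : l ≠ 0) : t l = cubicConic p q l :=
    ConicForm.ext (hp l hl h0).symm (hq l hl h0).symm (htl l ⟨hl, h0⟩)
  refine ⟨A, p, q, hAcard, ?_⟩
  ext c
  constructor
  · intro hc
    have hl : c.lam ∈ A := (hmem _).2 (Or.inr ⟨c, hc, rfl⟩)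
    have h0 := (hC.1 c hc).2
    refine ⟨c.lam, hl, h0, ?_⟩
    rw [← ht' _ hl h0]
    exact huniq hc (ht _ ⟨hl, h0⟩) (htl _ ⟨hl, h0⟩).symm
  · rintro ⟨l, hl, h0, rfl⟩
    rw [← ht' l hl h0]
    exact ht l ⟨hl, h0⟩

/-- A line through the nucleus contains one point of each conic besides the nucleus itself. -/
theorem IsMaximalArc.ncard_eq_seven [Fintype K] [Algebra (ZMod 2) K] (hK : Fintype.card K = 32)
    {C : Set (ConicForm K)} (hC : IsClosedConicSet C) (h : IsMaximalArc 8 (arcOfConics C)) :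
    C.ncard = 7 := by
  have : Finite (ConicForm K) := Finite.of_injective
    (fun c : ConicForm K => (c.α, c.β, c.lam)) fun c c' h => by
      simp only [Prod.mk.injEq] at h
      exact ConicForm.ext h.1 h.2.1 h.2.2
  have hl : (![1, 0, 0] : Fin 3 → K) ≠ 0 := fun h => one_ne_zero (congrFun h 0)
  have h1 := ncard_line_through_nucleus hK hC (Set.toFinite C) hl rfl
  have h2 := h.2.2 (Projectivization.mk K _ hl)
  omega

/-- The relation between the parameters of two families with isomorphic arcs. -/
theorem Iso.exists_relation [Fintype K] [Algebra (ZMod 2) K] (hK : Fintype.card K = 32)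
    {A A' : AddSubgroup K} (hA : Nat.card A = 8) (hA' : Nat.card A' = 8) {p q p' q' : Fin 3 → K}
    (h : Iso (arcOfConics (cubicFamily A p q)) (arcOfConics (cubicFamily A' p' q'))) :
    ∃ (σ : K ≃+* K) (s k a b c d : K), s ≠ 0 ∧ k = a * d + b * c ∧ k ≠ 0 ∧
      (∀ l ∈ A, s * σ l ∈ A') ∧ p' 0 * a ^ 2 + a * c + q' 0 * c ^ 2 = k * σ (p 0) ∧
      s ^ 3 * (p' 2 * a ^ 2 + q' 2 * c ^ 2) = k * σ (p 2) ∧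
      s ^ 3 * (p' 2 * b ^ 2 + q' 2 * d ^ 2) = k * σ (q 2) := by
  have hlam (A : AddSubgroup K) (p q) : ∀ D ∈ cubicFamily A p q, D.lam ≠ 0 := by
    rintro _ ⟨l, hl, h0, rfl⟩
    exact h0
  have hcard : (cubicFamily A' p' q').ncard = 7 := by rw [ncard_cubicFamily, hA']
  obtain ⟨σ, a, b, c, d, e, f, g, H⟩ := h.exists_matching hK (hlam A p q) (hlam A' p' q')
    (Set.finite_of_ncard_ne_zero (by omega)) hcard.le
  obtain ⟨l₀, hl₀, hl₀0⟩ : ∃ l ∈ A, l ≠ 0 := by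
    by_contra! h0
    have : A = ⊥ := by
      rw [eq_bot_iff]
      exact fun x hx => h0 x hx
    rw [this] at hA
    simp at hA
  obtain ⟨hδ, hg, -⟩ := H _ ⟨l₀, hl₀, hl₀0, rfl⟩
  obtain ⟨s, hs⟩ : ∃ s, s = (a * d + b * c) / g ^ 2 := ⟨_, rfl⟩
  have hrel (l) (hl : l ∈ A) (h0 : l ≠ 0) := H _ ⟨l, hl, h0, rfl⟩
  have key (l) (hl : l ∈ A) (h0 : l ≠ 0) : s * σ l ∈ A' ∧
      (cubicConic p' q' (s * σ l)).α * a ^ 2 + a * c + (cubicConic p' q' (s * σ l)).β * c ^ 2 +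
        (s * σ l) * e ^ 2 = (a * d + b * c) * σ (cubicConic p q l).α ∧
      (cubicConic p' q' (s * σ l)).α * b ^ 2 + b * d + (cubicConic p' q' (s * σ l)).β * d ^ 2 +
        (s * σ l) * f ^ 2 = (a * d + b * c) * σ (cubicConic p q l).β := by
    obtain ⟨-, -, _, ⟨l', hl', h0', rfl⟩, h1, h2, h3⟩ := hrel l hl h0
    have : l' = s * σ l := by
      simp only [cubicConic] at h1
      rw [hs]
      field_simp
      linear_combination h1
    subst this
    exact ⟨hl', h2, h3⟩
  -- The conclusion `r₁ = 0` is dropped: it involves the free parameters `e`, `f`.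
  have hcoef (r₀ r₁ r₂ : K) (h : ∀ l ∈ A, l ≠ 0 → r₀ + r₁ * σ l + r₂ * σ l ^ 3 = 0) :
      r₀ = 0 ∧ r₂ = 0 := by
    have h1 := cubic_coeff_eq_zero hA (r₀ := σ.symm r₀) (r₁ := σ.symm r₁) (r₂ := σ.symm r₂)
      (fun l hl h0 => σ.injective (by simpa using h l hl h0))
    simpa using And.intro h1.1 h1.2.2
  refine ⟨σ, s, _, a, b, c, d, ?_, rfl, hδ, fun l hl => ?_, ?_⟩
  · rw [hs]
    exact div_ne_zero hδ (pow_ne_zero 2 hg)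
  · by_cases h0 : l = 0
    · simp [h0]
    · exact (key l hl h0).1
  · have h1 := hcoef (p' 0 * a ^ 2 + a * c + q' 0 * c ^ 2 - (a * d + b * c) * σ (p 0))
      (s * (p' 1 * a ^ 2 + q' 1 * c ^ 2 + e ^ 2) - (a * d + b * c) * σ (p 1))
      (s ^ 3 * (p' 2 * a ^ 2 + q' 2 * c ^ 2) - (a * d + b * c) * σ (p 2)) fun l hl h0 => by
        have := (key l hl h0).2.1
        simp only [cubicConic, map_add, map_mul, map_pow] at this
        linear_combination this
    have h2 := hcoef (p' 0 * b ^ 2 + b * d + q' 0 * d ^ 2 - (a * d + b * c) * σ (q 0))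
      (s * (p' 1 * b ^ 2 + q' 1 * d ^ 2 + f ^ 2) - (a * d + b * c) * σ (q 1))
      (s ^ 3 * (p' 2 * b ^ 2 + q' 2 * d ^ 2) - (a * d + b * c) * σ (q 2)) fun l hl h0 => by
        have := (key l hl h0).2.2
        simp only [cubicConic, map_add, map_mul, map_pow] at this
        linear_combination this
    exact ⟨sub_eq_zero.1 h1.1, sub_eq_zero.1 h1.2, sub_eq_zero.1 h2.2⟩

end Families

/-! ### The primitive element and the traces of its powers. -/

section PrimitiveElement

variable {K : Type*} [Field K]

/-- Multiplying by `w¹³` and using `w³¹ = 1` gives `w¹⁴ = w¹³ + 1`; reducing `w¹⁸` with this rule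
brings the degree down to five. -/
theorem pow_five_of_pow_eighteen [CharP K 2] {w : K} (h31 : w ^ 31 = 1) (h : w ^ 18 + w = 1) :
    w ^ 5 = w ^ 2 + 1 := by
  have h18 : w ^ 18 = w + 1 := by grind
  have h14 : w ^ 14 = w ^ 13 + 1 := by
    have : w ^ 31 = w ^ 13 * w ^ 18 := by ring
    grind
  have h13 : w ^ 13 = w ^ 2 + w ^ 3 + w ^ 4 := by
    have h1 : w ^ 18 = w ^ 4 * w ^ 14 := by ring
    have h2 : w ^ 17 = w ^ 3 * w ^ 14 := by ring
    have h3 : w ^ 16 = w ^ 2 * w ^ 14 := by ring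
    have h4 : w ^ 15 = w * w ^ 14 := by ring
    rw [h14] at h1 h2 h3 h4
    grind
  have h14' : w ^ 14 = w * w ^ 13 := by ring
  grind

theorem isPrimitiveRoot_of_ne_one {w : K} (h31 : w ^ 31 = 1) (h1 : w ≠ 1) :
    IsPrimitiveRoot w 31 := by
  have : Fact (Nat.Prime 31) := ⟨by norm_num⟩
  exact IsPrimitiveRoot.iff_orderOf.2 (orderOf_eq_prime h31 h1)

/-- This lemma and the next four treat the irreducible quintics over GF(2) other than `x⁵ + x² + 1`:
in each case a suitable power of a root is a root of `x⁵ + x² + 1`. -/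
theorem pow_15_root {R : Type*} [CommRing R] [CharP R 2] {x : R} (h : x ^ 5 + x ^ 3 + 1 = 0) :
    (x ^ 15) ^ 5 = (x ^ 15) ^ 2 + 1 := by
  grind

theorem pow_5_root {R : Type*} [CommRing R] [CharP R 2] {x : R} (h : x ^ 5 + x ^ 3 + x ^ 2 + x + 1 = 0) :
    (x ^ 5) ^ 5 = (x ^ 5) ^ 2 + 1 := by
  grind

theorem pow_7_root {R : Type*} [CommRing R] [CharP R 2] {x : R} (h : x ^ 5 + x ^ 4 + x ^ 2 + x + 1 = 0) :
    (x ^ 7) ^ 5 = (x ^ 7) ^ 2 + 1 := by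
  grind

theorem pow_3_root {R : Type*} [CommRing R] [CharP R 2] {x : R} (h : x ^ 5 + x ^ 4 + x ^ 3 + x + 1 = 0) :
    (x ^ 3) ^ 5 = (x ^ 3) ^ 2 + 1 := by
  grind

theorem pow_11_root {R : Type*} [CommRing R] [CharP R 2] {x : R} (h : x ^ 5 + x ^ 4 + x ^ 3 + x ^ 2 + 1 = 0) :
    (x ^ 11) ^ 5 = (x ^ 11) ^ 2 + 1 := by
  grind

theorem exists_primitive_element [Fintype K] [CharP K 2] (hK : Fintype.card K = 32) :
    ∃ w : K, IsPrimitiveRoot w 31 ∧ w ^ 18 + w = 1 := by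
  classical
  obtain ⟨x, hx⟩ : ∃ x : K, x ∉ ({0, 1} : Finset K) := by
    by_contra! h
    have h1 := Finset.card_le_card (fun x _ => h x : (Finset.univ : Finset K) ⊆ {0, 1})
    have h2 := Finset.card_le_two (a := (0 : K)) (b := 1)
    rw [Finset.card_univ, hK] at h1
    omega
  simp only [Finset.mem_insert, Finset.mem_singleton, not_or] at hx
  have h31 : x ^ 31 = 1 := by
    have := FiniteField.pow_card_sub_one_eq_one x hx.1
    rwa [hK] at this
  -- Over GF(2), `x³¹ - 1` is `x + 1` times the six irreducible quintics; the long polynomial below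
  -- is half the integral difference of the two sides.
  have hfac : (x ^ 5 + x ^ 2 + 1) * (x ^ 5 + x ^ 3 + 1) * (x ^ 5 + x ^ 3 + x ^ 2 + x + 1) *
      (x ^ 5 + x ^ 4 + x ^ 2 + x + 1) * (x ^ 5 + x ^ 4 + x ^ 3 + x + 1) *
      (x ^ 5 + x ^ 4 + x ^ 3 + x ^ 2 + 1) = 0 := by
    have h1 : x + 1 ≠ 0 := by grind
    apply mul_left_cancel₀ h1
    rw [mul_zero]
    have h2 : (2 : K) = 0 := CharTwo.two_eq_zero
    linear_combination h31 + (1 + 2 * x ^ 1 + 5 * x ^ 2 + 11 * x ^ 3 + 21 * x ^ 4 + 38 * x ^ 5 + 63 * x ^ 6 +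
      96 * x ^ 7 + 139 * x ^ 8 + 189 * x ^ 9 + 248 * x ^ 10 + 308 * x ^ 11 +
      363 * x ^ 12 + 413 * x ^ 13 + 447 * x ^ 14 + 469 * x ^ 15 + 469 * x ^ 16 +
      447 * x ^ 17 + 413 * x ^ 18 + 363 * x ^ 19 + 308 * x ^ 20 + 248 * x ^ 21 +
      189 * x ^ 22 + 139 * x ^ 23 + 96 * x ^ 24 + 63 * x ^ 25 + 38 * x ^ 26 +
      21 * x ^ 27 + 11 * x ^ 28 + 5 * x ^ 29 + 2 * x ^ 30) * h2
  have hroot : ∃ j, (x ^ j) ^ 5 = (x ^ j) ^ 2 + 1 := by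
    simp only [mul_eq_zero] at hfac
    rcases hfac with ((((h | h) | h) | h) | h) | h
    · exact ⟨1, by grind⟩
    · exact ⟨15, pow_15_root h⟩
    · exact ⟨5, pow_5_root h⟩
    · exact ⟨7, pow_7_root h⟩
    · exact ⟨3, pow_3_root h⟩
    · exact ⟨11, pow_11_root h⟩
  obtain ⟨j, hj⟩ := hroot
  have hj31 : (x ^ j) ^ 31 = 1 := by rw [← pow_mul, mul_comm, pow_mul, h31, one_pow]
  refine ⟨x ^ j, isPrimitiveRoot_of_ne_one hj31 fun h1 => ?_, ?_⟩
  · rw [h1] at hj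
    grind
  · generalize x ^ j = w at hj
    grind

/-- The exponents `n` modulo `31` for which `wⁿ` has trace `1`. -/
def powTrace (n : ℕ) : ZMod 2 := if Nat.testBit 91635305 (n % 31) then 1 else 0

theorem powTrace_add_five (n : ℕ) : powTrace (n + 5) = powTrace (n + 2) + powTrace n := by
  have h : ∀ m < 31, powTrace (m + 5) = powTrace (m + 2) + powTrace m := by decide
  have h1 := h (n % 31) (Nat.mod_lt _ (by norm_num))
  simpa [powTrace, Nat.add_mod] using h1

/-- Both sides satisfy the recurrence given by `w⁵ = w² + 1` and agree for `n < 5`. It turns every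
later trace condition into a decidable statement about exponents. -/
theorem trace_pow [Fintype K] [Algebra (ZMod 2) K] (hK : Fintype.card K = 32) {w : K}
    (h5 : w ^ 5 = w ^ 2 + 1) (n : ℕ) : Tr K (w ^ n) = powTrace n := by
  have := charP_two K
  induction n using Nat.strong_induction_on with
  | h n ih =>
    by_cases hn : n < 5
    · have h1 : Tr K w = 0 := by
        rw [trace_eq_zero_iff hK]
        grind
      have h3 : Tr K (w ^ 3) = 1 := by
        rw [trace_eq_one_iff hK]
        grind
      interval_cases n
      · rw [pow_zero, trace_one hK]
        decide
      · rw [pow_one, h1]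
        decide
      · rw [trace_sq hK, h1]
        decide
      · rw [h3]
        decide
      · rw [show w ^ 4 = (w ^ 2) ^ 2 by ring, trace_sq hK, trace_sq hK, h1]
        decide
    · obtain ⟨m, rfl⟩ := Nat.exists_eq_add_of_le' (not_lt.1 hn)
      rw [powTrace_add_five, ← ih m (by omega), ← ih (m + 2) (by omega), ← map_add]
      congr 1
      linear_combination w ^ m * h5

end PrimitiveElement

/-- The exponents of the non-zero elements of the group generated by `1`, `w`, `w⁹`. -/
def groupExponents : List ℕ := [0, 1, 9, 16, 18, 21, 25]

theorem lt_of_mem_groupExponents : ∀ e ∈ groupExponents, e < 31 := by decide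

/-! ### Subgroups of order 8 under ΓL(1, 32). -/

section Group

variable {K : Type*} [Field K] [Fintype K]

/-- The conditions say that `a`, `b`, `c` form a basis of `A` over GF(2) when the characteristic is
2. -/
theorem exists_ne_of_card_eq_eight {A : AddSubgroup K} (hA : Nat.card A = 8) :
    ∃ a ∈ A, ∃ b ∈ A, ∃ c ∈ A, a ≠ 0 ∧ b ≠ 0 ∧ b ≠ a ∧ c ≠ 0 ∧ c ≠ a ∧ c ≠ b ∧ c ≠ a + b := by
  classical
  have hcard : (A : Set K).ncard = 8 := by
    rw [← Nat.card_coe_set_eq]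
    exact hA
  have hex (S : Finset K) (hS : S.card ≤ 4) : ∃ a ∈ A, a ∉ S := by
    have := Set.exists_mem_notMem_of_ncard_lt_ncard (s := (S : Set K)) (t := (A : Set K))
      (by rw [hcard, Set.ncard_coe_finset]; omega)
    simpa using this
  obtain ⟨a, ha, ha'⟩ := hex {0} (by simp)
  obtain ⟨b, hb, hb'⟩ := hex {0, a} (Finset.card_le_two.trans (by norm_num))
  obtain ⟨c, hc, hc'⟩ := hex {0, a, b, a + b} Finset.card_le_four
  simp only [Finset.mem_insert, Finset.mem_singleton, not_or] at ha' hb' hc'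
  exact ⟨a, ha, b, hb, c, hc, ha', hb'.1, hb'.2, hc'.1, hc'.2.1, hc'.2.2.1, hc'.2.2.2⟩

variable {w : K}

theorem exists_eq_pow (hK : Fintype.card K = 32) (hw : IsPrimitiveRoot w 31) {x : K} (hx : x ≠ 0) :
    ∃ i < 31, w ^ i = x := by
  refine hw.eq_pow_of_pow_eq_one ?_
  have := FiniteField.pow_card_sub_one_eq_one x hx
  rwa [hK] at this

variable [Algebra (ZMod 2) K]

/-- The group is the orthogonal complement of `w⁷` and `w¹⁴` under the trace form, which bounds it
from above; the seven powers are explicit sums of generators. -/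
theorem mem_closure_iff (hK : Fintype.card K = 32) (hw : IsPrimitiveRoot w 31)
    (h5 : w ^ 5 = w ^ 2 + 1) {x : K} :
    x ∈ AddSubgroup.closure {1, w, w ^ 9} ↔ x = 0 ∨ ∃ e ∈ groupExponents, x = w ^ e := by
  have := charP_two K
  constructor
  · intro hx
    have h (a : ℕ) (ha : a = 7 ∨ a = 14) : Tr K (w ^ a * x) = 0 := by
      induction hx using AddSubgroup.closure_induction with
      | mem y hy =>
        rcases hy with rfl | rfl | rfl <;> rcases ha with rfl | rfl
        · rw [mul_one, trace_pow hK h5]; decide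
        · rw [mul_one, trace_pow hK h5]; decide
        · rw [← pow_succ, trace_pow hK h5]; decide
        · rw [← pow_succ, trace_pow hK h5]; decide
        · rw [← pow_add, trace_pow hK h5]; decide
        · rw [← pow_add, trace_pow hK h5]; decide
      | zero => simp
      | add y z _ _ hy hz => rw [mul_add, map_add, hy, hz, add_zero]
      | neg y _ hy => rwa [CharTwo.neg_eq]
    by_cases h0 : x = 0
    · exact Or.inl h0
    · right
      obtain ⟨i, hi, rfl⟩ := exists_eq_pow hK hw h0
      have h7 := h 7 (Or.inl rfl)
      have h14 := h 14 (Or.inr rfl)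
      rw [← pow_add, trace_pow hK h5] at h7 h14
      have key : ∀ i < 31, powTrace (7 + i) = 0 → powTrace (14 + i) = 0 → i ∈ groupExponents := by
        decide
      exact ⟨i, key i hi h7 h14, rfl⟩
  · have m0 : (1 : K) ∈ AddSubgroup.closure {1, w, w ^ 9} := AddSubgroup.subset_closure (by simp)
    have m1 : w ∈ AddSubgroup.closure {1, w, w ^ 9} := AddSubgroup.subset_closure (by simp)
    have m9 : w ^ 9 ∈ AddSubgroup.closure {1, w, w ^ 9} := AddSubgroup.subset_closure (by simp)
    rintro (rfl | ⟨e, he, rfl⟩)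
    · exact zero_mem _
    · simp only [groupExponents, List.mem_cons, List.not_mem_nil, or_false] at he
      rcases he with rfl | rfl | rfl | rfl | rfl | rfl | rfl
      · simpa using m0
      · simpa using m1
      · exact m9
      · rw [show w ^ 16 = 1 + w ^ 9 by grind]
        exact add_mem m0 m9
      · rw [show w ^ 18 = 1 + w by grind]
        exact add_mem m0 m1
      · rw [show w ^ 21 = w + w ^ 9 by grind]
        exact add_mem m1 m9
      · rw [show w ^ 25 = 1 + w + w ^ 9 by grind]
        exact add_mem (add_mem m0 m1) m9

theorem pow_mem_closure_iff (hK : Fintype.card K = 32) (hw : IsPrimitiveRoot w 31)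
    (h5 : w ^ 5 = w ^ 2 + 1) (n : ℕ) :
    w ^ n ∈ AddSubgroup.closure {1, w, w ^ 9} ↔ n % 31 ∈ groupExponents := by
  rw [mem_closure_iff hK hw h5]
  have hn : w ^ n = w ^ (n % 31) := by
    rw [← pow_mod_orderOf, ← hw.eq_orderOf]
  constructor
  · rintro (h | ⟨e, he, h⟩)
    · exact absurd h (pow_ne_zero n (hw.ne_zero (by norm_num)))
    · rw [hn] at h
      rwa [hw.pow_inj (Nat.mod_lt _ (by norm_num)) (lt_of_mem_groupExponents e he) h]
  · exact fun h => Or.inr ⟨_, h, hn⟩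

theorem card_closure (hK : Fintype.card K = 32) (hw : IsPrimitiveRoot w 31)
    (h5 : w ^ 5 = w ^ 2 + 1) : Nat.card (AddSubgroup.closure {1, w, w ^ 9}) = 8 := by
  classical
  have h : (AddSubgroup.closure {1, w, w ^ 9} : Set K) =
      insert 0 ((w ^ ·) '' (groupExponents.toFinset : Set ℕ)) := by
    ext x
    rw [SetLike.mem_coe, mem_closure_iff hK hw h5]
    simp [eq_comm]
  have hlt := lt_of_mem_groupExponents
  change Nat.card (AddSubgroup.closure {1, w, w ^ 9} : Set K) = 8
  rw [Nat.card_coe_set_eq, h, Set.ncard_insert_of_notMem, Set.InjOn.ncard_image,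
    Set.ncard_coe_finset]
  · decide
  · intro i hi j hj hij
    exact hw.pow_inj (hlt i (by simpa using hi)) (hlt j (by simpa using hj)) hij
  · rintro ⟨i, -, h⟩
    exact pow_ne_zero i (hw.ne_zero (by norm_num)) h

/-- The group generated by `1`, `w`, `w⁹` has trivial stabilizer in `ΓL(1, 32)`. -/
theorem stabilizer_trivial (hK : Fintype.card K = 32) (hw : IsPrimitiveRoot w 31)
    (h5 : w ^ 5 = w ^ 2 + 1) {σ : K ≃+* K} {s : K} (hs : s ≠ 0)
    (h : ∀ l ∈ AddSubgroup.closure {1, w, w ^ 9}, s * σ l ∈ AddSubgroup.closure {1, w, w ^ 9}) :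
    s = 1 ∧ σ w = w := by
  have hw0 : w ≠ 0 := hw.ne_zero (by norm_num)
  obtain ⟨e, he, rfl⟩ := exists_eq_pow hK hw hs
  obtain ⟨i, hi, hσ⟩ := exists_eq_pow hK hw ((map_ne_zero σ).2 hw0)
  have ht (n : ℕ) : powTrace (i * n) = powTrace n := by
    rw [← trace_pow hK h5, ← trace_pow hK h5, pow_mul, hσ, ← map_pow, trace_ringEquiv hK]
  have m0 := h 1 (AddSubgroup.subset_closure (by simp))
  have m1 := h w (AddSubgroup.subset_closure (by simp))
  have m9 := h (w ^ 9) (AddSubgroup.subset_closure (by simp))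
  rw [map_one, mul_one, pow_mem_closure_iff hK hw h5] at m0
  rw [← hσ, ← pow_add, pow_mem_closure_iff hK hw h5] at m1
  rw [map_pow, ← hσ, ← pow_mul, ← pow_add, pow_mem_closure_iff hK hw h5] at m9
  -- `σ w = wⁱ` must preserve traces, and the images of `1`, `w`, `w⁹` must stay in the group; a
  -- search over `i` and `e` leaves only the identity.
  have key : ∀ i < 31, (∀ n < 31, powTrace (i * n) = powTrace n) →
      ∀ e ∈ groupExponents, (e + i) % 31 ∈ groupExponents →
      (e + i * 9) % 31 ∈ groupExponents → e = 0 ∧ i = 1 := by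
    decide +kernel
  rw [Nat.mod_eq_of_lt he] at m0
  obtain ⟨rfl, rfl⟩ := key i hi (fun n _ => ht n) e m0 m1 m9
  exact ⟨pow_zero w, by rw [← hσ, pow_one]⟩

/-- `ΓL(1, 32)` is transitive on the additive subgroups of order `8`. -/
theorem exists_map_to_closure (hK : Fintype.card K = 32) (hw : IsPrimitiveRoot w 31)
    (h5 : w ^ 5 = w ^ 2 + 1) {A : AddSubgroup K} (hA : Nat.card A = 8) :
    ∃ (σ : K ≃+* K) (s : K), s ≠ 0 ∧
      ∀ l, l ∈ A ↔ s * σ l ∈ AddSubgroup.closure {1, w, w ^ 9} := by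
  classical
  have := charP_two K
  have hw0 : w ≠ 0 := hw.ne_zero (by norm_num)
  obtain ⟨a, ha, b, hb, c, hc, ha0, hb0, hba, hc0, hca, hcb, hcab⟩ := exists_ne_of_card_eq_eight hA
  obtain ⟨i, hi, hib⟩ := exists_eq_pow hK hw (div_ne_zero hb0 ha0)
  obtain ⟨j, hj, hjc⟩ := exists_eq_pow hK hw (div_ne_zero hc0 ha0)
  -- After division by `a` the basis is `1, wⁱ, wʲ`; a Frobenius power `2 ^ r` followed by
  -- multiplication by `wᵉ` moves it into the group.
  have key : ∀ i < 31, ∀ j < 31, ∃ r < 5, ∃ e ∈ groupExponents,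
      (e + i * 2 ^ r) % 31 ∈ groupExponents ∧ (e + j * 2 ^ r) % 31 ∈ groupExponents := by
    decide +kernel
  obtain ⟨r, -, e, he, h1, h2⟩ := key i hi j hj
  let σ : K ≃+* K := iterateFrobeniusEquiv K 2 r
  let s : K := w ^ e * σ a⁻¹
  have hs : s ≠ 0 := mul_ne_zero (pow_ne_zero _ hw0) ((map_ne_zero σ).2 (inv_ne_zero ha0))
  let φ : K →+ K := (AddMonoidHom.mulLeft s).comp (σ : K →+ K)
  have hφ (x) : φ x = s * σ x := rfl
  have hφ' (x) : φ x = w ^ e * (x / a) ^ 2 ^ r := by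
    have : σ (x / a) = (x / a) ^ 2 ^ r := iterateFrobeniusEquiv_def ..
    rw [hφ, ← this, div_eq_mul_inv, map_mul]
    ring
  have hinj : Function.Injective φ := by
    intro x y h
    rw [hφ, hφ] at h
    exact σ.injective (mul_left_cancel₀ hs h)
  let B := (AddSubgroup.closure {1, w, w ^ 9}).comap φ
  have hB : Nat.card B = 8 := by
    rw [← card_closure hK hw h5]
    exact Nat.card_congr ((Equiv.ofBijective φ (Finite.injective_iff_bijective.1 hinj)).subtypeEquiv
      fun x => Iff.rfl)
  have haB : a ∈ B := by
    change φ a ∈ AddSubgroup.closure ({1, w, w ^ 9} : Set K)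
    rwa [hφ', div_self ha0, one_pow, mul_one, pow_mem_closure_iff hK hw h5,
      Nat.mod_eq_of_lt (lt_of_mem_groupExponents e he)]
  have hbB : b ∈ B := by
    change φ b ∈ AddSubgroup.closure ({1, w, w ^ 9} : Set K)
    rwa [hφ', ← hib, ← pow_mul, ← pow_add, pow_mem_closure_iff hK hw h5]
  have hcB : c ∈ B := by
    change φ c ∈ AddSubgroup.closure ({1, w, w ^ 9} : Set K)
    rwa [hφ', ← hjc, ← pow_mul, ← pow_add, pow_mem_closure_iff hK hw h5]
  have hAB : A = B := by
    -- The order divides `8` and is at least `5`.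
    have h8 : Nat.card (A ⊓ B : AddSubgroup K) = 8 := by
      have hdvd : Nat.card (A ⊓ B : AddSubgroup K) ∣ 8 := hA ▸ AddSubgroup.card_dvd_of_le inf_le_left
      have hsub : (({0, a, b, c, a + b} : Finset K) : Set K) ⊆ ((A ⊓ B : AddSubgroup K) : Set K) := by
        intro x hx
        simp only [Finset.coe_insert, Finset.coe_singleton, Set.mem_insert_iff,
          Set.mem_singleton_iff] at hx
        rcases hx with rfl | rfl | rfl | rfl | rfl
        · exact zero_mem _
        · exact ⟨ha, haB⟩
        · exact ⟨hb, hbB⟩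
        · exact ⟨hc, hcB⟩
        · exact ⟨add_mem ha hb, add_mem haB hbB⟩
      have h5' : ({0, a, b, c, a + b} : Finset K).card = 5 := by
        have hab : a + b ≠ 0 := by grind
        have hab' : a + b ≠ a := by grind
        have hab'' : a + b ≠ b := by grind
        rw [Finset.card_insert_of_notMem, Finset.card_insert_of_notMem,
          Finset.card_insert_of_notMem, Finset.card_insert_of_notMem, Finset.card_singleton] <;>
          simp <;> grind
      have h5'' := Set.ncard_le_ncard hsub (Set.toFinite _)
      rw [Set.ncard_coe_finset, h5', ← Nat.card_coe_set_eq] at h5''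
      have h5'' : 5 ≤ Nat.card (A ⊓ B : AddSubgroup K) := h5''
      have hle := Nat.le_of_dvd (by norm_num) hdvd
      generalize Nat.card (A ⊓ B : AddSubgroup K) = n at *
      interval_cases n <;> omega
    have hA' := AddSubgroup.eq_of_le_of_card_ge (inf_le_left : A ⊓ B ≤ A) (by rw [h8, hA])
    have hB' := AddSubgroup.eq_of_le_of_card_ge (inf_le_right : A ⊓ B ≤ B) (by rw [h8, hB])
    rw [← hA', hB']
  refine ⟨σ, s, hs, fun l => ?_⟩
  rw [hAB]
  rfl

end Group

/-! ### Normal forms and the Denniston criterion. -/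

section Reduction

variable {K : Type*} [Field K] [Algebra (ZMod 2) K]

/-- The consequence of the trace condition for three linearly dependent parameters. -/
theorem trace_add_trace_eq_one {A : AddSubgroup K} {p q : Fin 3 → K}
    (hp : p 2 = 0) (hC : IsClosedConicSet (cubicFamily A p q)) {l m : K} (hl : l ∈ A) (hm : m ∈ A)
    (hl0 : l ≠ 0) (hm0 : m ≠ 0) (hlm : l + m ≠ 0) :
    Tr K (p 0 * q 0) + Tr K (p 0 * q 2 * (l * m * (l + m))) = 1 := by
  have := charP_two K
  have htwo : (2 : K) = 0 := CharTwo.two_eq_zero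
  rw [isClosedConicSet_cubicFamily_iff] at hC
  have h1 := hC l hl hl0
  have h2 := hC m hm hm0
  have h3 := hC (l + m) (A.add_mem hl hm) hlm
  -- With `p₂ = 0`, every non-constant term of `α β` except `p₀ q₂ l³` is additive in `l` and
  -- cancels, and `l³ + m³ + (l + m)³ = l m (l + m)`.
  have key : p 0 * q 0 + p 0 * q 2 * (l * m * (l + m)) =
      (cubicConic p q l).α * (cubicConic p q l).β + (cubicConic p q m).α * (cubicConic p q m).β +
        (cubicConic p q (l + m)).α * (cubicConic p q (l + m)).β := by
    simp only [cubicConic, hp]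
    grind
  rw [← map_add, key, map_add, map_add, h1, h2, h3]
  decide

variable [Fintype K]

/-- A substitution in `SL(2, K)` removes the cubic term of `α`. -/
theorem exists_iso_snd_zero (hK : Fintype.card K = 32) {A : AddSubgroup K} {p q : Fin 3 → K}
    (hC : IsClosedConicSet (cubicFamily A p q)) : ∃ p' q' : Fin 3 → K, p' 2 = 0 ∧
      IsClosedConicSet (cubicFamily A p' q') ∧
      Iso (arcOfConics (cubicFamily A p' q')) (arcOfConics (cubicFamily A p q)) := by
  have := charP_two K
  have htwo : (2 : K) = 0 := CharTwo.two_eq_zero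
  rw [isClosedConicSet_cubicFamily_iff] at hC
  -- `(a, c)` is a zero of `p₂ x² + q₂ y²`, which is the square of a linear form, completed to
  -- determinant `1`.
  obtain ⟨a, b, c, d, hδ, h2⟩ : ∃ a b c d : K, a * d + b * c = 1 ∧
      p 2 * a ^ 2 + q 2 * c ^ 2 = 0 := by
    by_cases h : q 2 = 0
    · exact ⟨0, 1, 1, 0, by ring, by rw [h]; ring⟩
    · obtain ⟨a, ha⟩ := exists_sq_eq hK (q 2)
      obtain ⟨c, hc⟩ := exists_sq_eq hK (p 2)
      have ha0 : a ≠ 0 := by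
        rintro rfl
        simp at ha
        exact h ha.symm
      refine ⟨a, 0, c, a⁻¹, by field_simp; ring, ?_⟩
      rw [ha, hc]
      linear_combination p 2 * q 2 * htwo
  let p' : Fin 3 → K := ![p 0 * a ^ 2 + a * c + q 0 * c ^ 2, p 1 * a ^ 2 + q 1 * c ^ 2, 0]
  let q' : Fin 3 → K := ![p 0 * b ^ 2 + b * d + q 0 * d ^ 2, p 1 * b ^ 2 + q 1 * d ^ 2,
    p 2 * b ^ 2 + q 2 * d ^ 2]
  have hα (l : K) : (cubicConic p' q' l).α =
      (cubicConic p q l).α * a ^ 2 + a * c + (cubicConic p q l).β * c ^ 2 := by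
    simp only [cubicConic, p', Matrix.cons_val]
    linear_combination -l ^ 3 * h2
  have hβ (l : K) : (cubicConic p' q' l).β =
      (cubicConic p q l).α * b ^ 2 + b * d + (cubicConic p q l).β * d ^ 2 := by
    simp only [cubicConic, q', Matrix.cons_val]
    ring
  refine ⟨p', q', rfl, (isClosedConicSet_cubicFamily_iff A p' q').2 fun l hl h0 => ?_, ?_⟩
  · have h := hC l hl h0
    rw [hα, hβ]
    generalize (cubicConic p q l).α = x at *
    generalize (cubicConic p q l).β = y at *
    -- Invariance of the Arf invariant: the product changes only by terms `t² + t`, of trace zero.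
    have hexp : (x * a ^ 2 + a * c + y * c ^ 2) * (x * b ^ 2 + b * d + y * d ^ 2) =
        x * y + ((x * a * b) ^ 2 + x * a * b) + ((y * c * d) ^ 2 + y * c * d) +
          ((a * d) ^ 2 + a * d) := by
      linear_combination (x * y * (a * d + b * c + 1) + x * a * b + y * c * d + a * d) * hδ -
        (x * y * a * b * c * d + (a * d) ^ 2) * htwo
    rw [hexp]
    simp only [map_add, trace_sq hK, h, CharTwo.add_self_eq_zero, add_zero]
  · refine iso_arcOfConics (RingEquiv.refl K) (a := a) (b := b) (c := c) (d := d) (e := 0) (f := 0)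
      (g := 1) (by rw [hδ]; exact one_ne_zero) one_ne_zero
      (fun D D' => ∃ l, D = cubicConic p' q' l ∧ D' = cubicConic p q l) ?_ ?_ ?_
    · rintro _ _ ⟨l, rfl, rfl⟩
      simp only [hδ, RingEquiv.refl_apply, hα, hβ]
      exact ⟨by simp [cubicConic], by ring, by ring⟩
    · rintro _ ⟨l, hl, h0, rfl⟩
      exact ⟨_, ⟨l, hl, h0, rfl⟩, l, rfl, rfl⟩
    · rintro _ ⟨l, hl, h0, rfl⟩
      exact ⟨_, ⟨l, hl, h0, rfl⟩, l, rfl, rfl⟩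

/-- The parameter group can be moved by `ΓL(1, K)`. -/
theorem exists_iso_of_map (hK : Fintype.card K = 32) {A B : AddSubgroup K} {p q : Fin 3 → K}
    (hC : IsClosedConicSet (cubicFamily A p q)) {σ : K ≃+* K} {s : K} (hs : s ≠ 0)
    (hAB : ∀ l, l ∈ A ↔ s * σ l ∈ B) : ∃ p' q' : Fin 3 → K, p' 2 = σ (p 2) / s ^ 3 ∧
      IsClosedConicSet (cubicFamily B p' q') ∧
      Iso (arcOfConics (cubicFamily A p q)) (arcOfConics (cubicFamily B p' q')) := by
  have := charP_two K
  rw [isClosedConicSet_cubicFamily_iff] at hC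
  -- Scaling `z` by `g` with `g² = s⁻¹` multiplies `lam` by `s`.
  obtain ⟨g, hg⟩ := exists_sq_eq hK s⁻¹
  have hg0 : g ≠ 0 := by
    rintro rfl
    simp at hg
    exact hs hg.symm
  let p' : Fin 3 → K := ![σ (p 0), σ (p 1) / s, σ (p 2) / s ^ 3]
  let q' : Fin 3 → K := ![σ (q 0), σ (q 1) / s, σ (q 2) / s ^ 3]
  have hα (l : K) : (cubicConic p' q' (s * σ l)).α = σ (cubicConic p q l).α := by
    simp only [cubicConic, p', Matrix.cons_val, map_add, map_mul, map_pow]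
    field_simp
  have hβ (l : K) : (cubicConic p' q' (s * σ l)).β = σ (cubicConic p q l).β := by
    simp only [cubicConic, q', Matrix.cons_val, map_add, map_mul, map_pow]
    field_simp
  have hsurj (m : K) (hm : m ∈ B) (h0 : m ≠ 0) : ∃ l ∈ A, l ≠ 0 ∧ m = s * σ l := by
    have hm' : s * σ (σ.symm (m / s)) = m := by
      rw [RingEquiv.apply_symm_apply]
      field_simp
    refine ⟨σ.symm (m / s), (hAB _).2 (by rwa [hm']), ?_, hm'.symm⟩
    simp [h0, hs]
  refine ⟨p', q', rfl, (isClosedConicSet_cubicFamily_iff B p' q').2 fun m hm h0 => ?_, ?_⟩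
  · obtain ⟨l, hl, hl0, rfl⟩ := hsurj m hm h0
    rw [hα, hβ, ← map_mul, trace_ringEquiv hK]
    exact hC l hl hl0
  · refine iso_arcOfConics σ (a := 1) (b := 0) (c := 0) (d := 1) (e := 0) (f := 0)
      (g := g) (by simp) hg0
      (fun D D' => ∃ l, D = cubicConic p q l ∧ D' = cubicConic p' q' (s * σ l)) ?_ ?_ ?_
    · rintro _ _ ⟨l, rfl, rfl⟩
      rw [hα, hβ, hg]
      refine ⟨?_, by ring, by ring⟩
      simp only [cubicConic]
      field_simp
      ring
    · rintro _ ⟨l, hl, h0, rfl⟩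
      exact ⟨_, ⟨_, (hAB l).1 hl, by simp [hs, h0], rfl⟩, l, rfl, rfl⟩
    · rintro _ ⟨m, hm, h0, rfl⟩
      obtain ⟨l, hl, hl0, rfl⟩ := hsurj m hm h0
      exact ⟨_, ⟨l, hl, hl0, rfl⟩, l, rfl, rfl⟩

/-- The family with `α = p₀ + p₁ l`, `β = q₀ + q₁ l + q₂ l³` depends only on `A`, `p₀ q₂` up to
isomorphism. -/
theorem iso_normal_form (hK : Fintype.card K = 32) {A : AddSubgroup K} {p q : Fin 3 → K}
    (hp : p 2 = 0) (h0 : Tr K (p 0 * q 0) = 1) {r : Fin 3 → K} (hr : Tr K (r 0) = 1)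
    (hr2 : r 2 = p 0 * q 2) :
    Iso (arcOfConics (cubicFamily A ![1, 0, 0] r)) (arcOfConics (cubicFamily A p q)) := by
  have := charP_two K
  have htwo : (2 : K) = 0 := CharTwo.two_eq_zero
  have hp0 : p 0 ≠ 0 := by
    intro h
    simp [h] at h0
  obtain ⟨d, hd⟩ := exists_sq_eq hK (p 0)
  have hd0 : d ≠ 0 := by
    rintro rfl
    simp at hd
    exact hp0 hd.symm
  -- `d` scales the constant of `α` to `1`, `t` moves the constant of `β` from `p₀ q₀` to `r₀`, and
  -- `e`, `f` absorb all linear terms, so `r 1` is arbitrary.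
  obtain ⟨t, ht⟩ := exists_sq_add_self_eq hK (x := p 0 * q 0 + r 0) (by
    rw [map_add, h0, hr]
    decide)
  obtain ⟨e, he⟩ := exists_sq_eq hK (p 1 / p 0)
  obtain ⟨f, hf⟩ := exists_sq_eq hK (p 1 * (t / d) ^ 2 + q 1 * d ^ 2 + r 1)
  refine iso_arcOfConics (RingEquiv.refl K) (a := d⁻¹) (b := t / d) (c := 0) (d := d) (e := e)
    (f := f) (g := 1) (by simp [hd0]) one_ne_zero
    (fun D D' => ∃ l, D = cubicConic ![1, 0, 0] r l ∧ D' = cubicConic p q l) ?_ ?_ ?_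
  · rintro _ _ ⟨l, rfl, rfl⟩
    simp only [RingEquiv.refl_apply, cubicConic, he, hf, Matrix.cons_val, hp, hr2]
    refine ⟨by simp [hd0], ?_, ?_⟩
    · rw [← hd]
      field_simp
      linear_combination p 1 * l * htwo
    · rw [← hd] at ht ⊢
      field_simp
      linear_combination d ^ 2 * ht + (p 1 * l * t ^ 2 + d ^ 4 * q 0 + d ^ 4 * l * q 1) * htwo
  · rintro _ ⟨l, hl, h0, rfl⟩
    exact ⟨_, ⟨l, hl, h0, rfl⟩, l, rfl, rfl⟩
  · rintro _ ⟨l, hl, h0, rfl⟩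
    exact ⟨_, ⟨l, hl, h0, rfl⟩, l, rfl, rfl⟩

/-- The family is of Denniston type if both cubic terms vanish. -/
theorem isDennistonType_of_cubic_eq_zero (hK : Fintype.card K = 32) {A : AddSubgroup K}
    {p q : Fin 3 → K} (hp : p 2 = 0) (hq : q 2 = 0) (h0 : Tr K (p 0 * q 0) = 1) :
    IsDennistonType (arcOfConics (cubicFamily A p q)) := by
  have := charP_two K
  have htwo : (2 : K) = 0 := CharTwo.two_eq_zero
  have hp0 : p 0 ≠ 0 := by
    intro h
    simp [h] at h0
  have hq0 : q 0 ≠ 0 := by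
    intro h
    simp [h] at h0
  obtain ⟨a, ha⟩ := exists_sq_eq hK (q 0)
  have ha0 : a ≠ 0 := by
    rintro rfl
    simp at ha
    exact hq0 ha.symm
  obtain ⟨e, he⟩ := exists_sq_eq hK (p 1 * q 0)
  obtain ⟨f, hf⟩ := exists_sq_eq hK (q 1 / q 0)
  refine ⟨p 0 * q 0, A, h0, ?_⟩
  rw [dennistonConics_eq_cubicFamily]
  refine iso_arcOfConics (RingEquiv.refl K) (a := a) (b := 0) (c := 0) (d := a⁻¹) (e := e)
    (f := f) (g := 1) (by simp [ha0]) one_ne_zero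
    (fun D D' => ∃ l, D = cubicConic ![p 0 * q 0, 0, 0] ![1, 0, 0] l ∧ D' = cubicConic p q l)
    ?_ ?_ ?_
  · rintro _ _ ⟨l, rfl, rfl⟩
    simp only [RingEquiv.refl_apply, cubicConic, he, hf, Matrix.cons_val, hp, hq]
    refine ⟨by simp [ha0], ?_, ?_⟩
    · rw [← ha]
      field_simp
      linear_combination a ^ 2 * p 1 * l * htwo
    · rw [← ha] at hq0 ⊢
      field_simp
      linear_combination q 1 * l * htwo
  · rintro _ ⟨l, hl, h0, rfl⟩
    exact ⟨_, ⟨l, hl, h0, rfl⟩, l, rfl, rfl⟩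
  · rintro _ ⟨l, hl, h0, rfl⟩
    exact ⟨_, ⟨l, hl, h0, rfl⟩, l, rfl, rfl⟩

/-- An arc of the normal form with a non-zero cubic coefficient is not of Denniston type. -/
theorem not_isDennistonType (hK : Fintype.card K = 32) {A : AddSubgroup K} (hA : Nat.card A = 8)
    {p q : Fin 3 → K} (hp : p 2 = 0) (hq : q 2 ≠ 0)
    (hC : IsClosedConicSet (cubicFamily A p q)) :
    ¬ IsDennistonType (arcOfConics (cubicFamily A p q)) := by
  rintro ⟨α, B, hα, hiso⟩
  have hmax := (isMaximalArc_cubicFamily hK hA hC).of_iso hiso.symm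
  rw [dennistonConics_eq_cubicFamily] at hiso hmax
  have hcl : IsClosedConicSet (cubicFamily B ![α, 0, 0] ![1, 0, 0]) := by
    rw [isClosedConicSet_cubicFamily_iff]
    intro l _ _
    simpa [cubicConic] using hα
  have hcard := hmax.ncard_eq_seven hK hcl
  rw [ncard_cubicFamily] at hcard
  obtain ⟨σ, s, k, a, b, c, d, hs, rfl, hk, -, -, h1, h2⟩ :=
    hiso.exists_relation hK (by omega) hA
  -- Both cubic coefficients on the Denniston side vanish, which forces `q₂ c² = q₂ d² = 0` and
  -- makes the substitution singular.
  have hc : c = 0 := by simpa [hp, hs, hq] using h1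
  have hd : d = 0 := by simpa [hp, hs, hq] using h2
  simp [hc, hd] at hk

end Reduction

/-! ### The three classes. -/

section Classification

variable {K : Type*} [Field K] [Fintype K] [Algebra (ZMod 2) K] {w : K}

theorem isClosedConicSet_mathonConics (hK : Fintype.card K = 32) (hw : IsPrimitiveRoot w 31)
    (h5 : w ^ 5 = w ^ 2 + 1) {e : ℕ × ℕ × ℕ} (he : e ∈ mathonExponents) :
    IsClosedConicSet (mathonConics w e) := by
  rw [mathonConics_eq_cubicFamily, isClosedConicSet_cubicFamily_iff]
  intro l hl h0
  obtain ⟨n, hn, rfl⟩ := ((mem_closure_iff hK hw h5).1 hl).resolve_left h0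
  have key : ∀ e ∈ mathonExponents, ∀ n ∈ groupExponents,
      powTrace e.1 + powTrace (e.2.1 + n) + powTrace (e.2.2 + n * 3) = 1 := by
    decide
  simp only [cubicConic, Matrix.cons_val, zero_mul, add_zero, one_mul, map_add, ← pow_mul,
    ← pow_add, trace_pow hK h5]
  exact key e he n hn

theorem isProperMathonArc_mathonConics (hK : Fintype.card K = 32) (hw : IsPrimitiveRoot w 31)
    (h5 : w ^ 5 = w ^ 2 + 1) {e : ℕ × ℕ × ℕ} (he : e ∈ mathonExponents) :
    IsProperMathonArc 8 (arcOfConics (mathonConics w e)) := by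
  have hC := isClosedConicSet_mathonConics hK hw h5 he
  refine ⟨?_, ⟨_, hC, Iso.refl _⟩, ?_⟩ <;> rw [mathonConics_eq_cubicFamily] at hC ⊢
  · exact isMaximalArc_cubicFamily hK (card_closure hK hw h5) hC
  · exact not_isDennistonType hK (card_closure hK hw h5) rfl
      (pow_ne_zero _ (hw.ne_zero (by norm_num))) hC

theorem not_iso_mathonConics (hK : Fintype.card K = 32) (hw : IsPrimitiveRoot w 31)
    (h5 : w ^ 5 = w ^ 2 + 1) {e e' : ℕ × ℕ × ℕ} (he : e ∈ mathonExponents)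
    (he' : e' ∈ mathonExponents) (hne : e ≠ e') :
    ¬ Iso (arcOfConics (mathonConics w e)) (arcOfConics (mathonConics w e')) := by
  intro hiso
  rw [mathonConics_eq_cubicFamily, mathonConics_eq_cubicFamily] at hiso
  have hw0 : w ≠ 0 := hw.ne_zero (by norm_num)
  obtain ⟨σ, s, k, a, b, c, d, hs, hk', hk, hst, h0, h1, h2⟩ :=
    hiso.exists_relation hK (card_closure hK hw h5) (card_closure hK hw h5)
  obtain ⟨rfl, hσ⟩ := stabilizer_trivial hK hw h5 hs hst
  -- Neither `α` has a cubic term, so `c = 0`; both have constant term `1`, so `a² = k = a d`. Then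
  -- the cubic coefficients of `β` agree.
  have hc : c = 0 := by simpa [hw0] using h1
  subst hc
  have ha : a ≠ 0 := by
    rintro rfl
    simp [hk'] at hk
  have h0 : a ^ 2 = k := by simpa using h0
  have had : a = d := by
    apply mul_left_cancel₀ ha
    linear_combination h0 + hk'
  subst had
  have h2 : w ^ e'.2.2 * a ^ 2 = k * w ^ e.2.2 := by simpa [hσ] using h2
  have h3 : w ^ e'.2.2 = w ^ e.2.2 := by
    apply mul_right_cancel₀ hk
    rw [← h0] at h2 ⊢
    linear_combination h2
  have key : ∀ e ∈ mathonExponents, ∀ e' ∈ mathonExponents,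
      e.2.2 < 31 ∧ (e'.2.2 = e.2.2 → e = e') := by
    decide
  exact hne ((key e he e' he').2 (hw.pow_inj (key e' he' e he).1 (key e he e' he').1 h3))

theorem exists_iso_mathonConics (hK : Fintype.card K = 32) (hw : IsPrimitiveRoot w 31)
    (h5 : w ^ 5 = w ^ 2 + 1) {S : Set (PG2 K)} (hS : IsProperMathonArc 8 S) :
    ∃ e ∈ mathonExponents, Iso (arcOfConics (mathonConics w e)) S := by
  have := charP_two K
  have hw0 : w ≠ 0 := hw.ne_zero (by norm_num)
  have h31 : w ^ 31 = 1 := hw.pow_eq_one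
  obtain ⟨hmax, ⟨C, hC, hiso⟩, hnot⟩ := hS
  obtain ⟨A, p, q, hA, rfl⟩ :=
    hC.exists_eq_cubicFamily ((hmax.of_iso hiso.symm).ncard_eq_seven hK hC)
  obtain ⟨p₁, q₁, hp₁, hC₁, hiso₁⟩ := exists_iso_snd_zero hK hC
  obtain ⟨σ, s, hs, hσ⟩ := exists_map_to_closure hK hw h5 hA
  obtain ⟨p₂, q₂, hp₂, hC₂, hiso₂⟩ := exists_iso_of_map hK hC₁ hs hσ
  rw [hp₁, map_zero, zero_div] at hp₂
  have hiso₃ := (hiso₂.symm.trans hiso₁).trans hiso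
  have hline (i j m : ℕ) (hi : i ∈ groupExponents) (hj : j ∈ groupExponents)
      (hm : m ∈ groupExponents) (h : w ^ i + w ^ j = w ^ m) :
      Tr K (p₂ 0 * q₂ 0) + Tr K (p₂ 0 * q₂ 2 * w ^ (i + j + m)) = 1 := by
    have hmem {n} (hn : n ∈ groupExponents) := (mem_closure_iff hK hw h5).2 (Or.inr ⟨n, hn, rfl⟩)
    have h1 := trace_add_trace_eq_one hp₂ hC₂ (hmem hi) (hmem hj) (pow_ne_zero i hw0)
      (pow_ne_zero j hw0) (by rw [h]; exact pow_ne_zero m hw0)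
    rwa [h, ← pow_add, ← pow_add] at h1
  -- Four of the seven lines of the Fano plane on `A \ {0}`; they already suffice to determine `p₂ 0
  -- * q₂ 2`.
  have l₁ := hline 0 1 18 (by decide) (by decide) (by decide) (by grind)
  have l₂ := hline 0 9 16 (by decide) (by decide) (by decide) (by grind)
  have l₃ := hline 1 9 21 (by decide) (by decide) (by decide) (by grind)
  have l₄ := hline 0 21 25 (by decide) (by decide) (by decide) (by grind)
  by_cases hc : p₂ 0 * q₂ 2 = 0
  · exfalso
    rw [hc, zero_mul, map_zero, add_zero] at l₁
    have hp0 : p₂ 0 ≠ 0 := by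
      intro h
      simp [h] at l₁
    have hd := isDennistonType_of_cubic_eq_zero hK (A := AddSubgroup.closure {1, w, w ^ 9}) hp₂
      ((mul_eq_zero.1 hc).resolve_left hp0) l₁
    obtain ⟨α, B, hα, hB⟩ := hd
    exact hnot ⟨α, B, hα, hB.trans hiso₃⟩
  · obtain ⟨i, hi, hic⟩ := exists_eq_pow hK hw hc
    rw [← hic, ← pow_add, trace_pow hK h5] at l₁ l₂ l₃ l₄
    -- The case `t = 0` has no solution; for `t = 1` the surviving exponents are those of the cubic
    -- coefficients in `mathonExponents`.
    have key : ∀ i < 31, ∀ t : ZMod 2, t + powTrace (i + (0 + 1 + 18)) = 1 ∧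
        t + powTrace (i + (0 + 9 + 16)) = 1 ∧ t + powTrace (i + (1 + 9 + 21)) = 1 ∧
        t + powTrace (i + (0 + 21 + 25)) = 1 → t = 1 ∧ (i = 4 ∨ i = 14 ∨ i = 8) := by
      decide
    obtain ⟨ht, hi'⟩ := key i hi _ ⟨l₁, l₂, l₃, l₄⟩
    obtain ⟨e, he, rfl, he1⟩ : ∃ e ∈ mathonExponents, e.2.2 = i ∧ powTrace e.1 = 1 := by
      rcases hi' with rfl | rfl | rfl <;> decide
    refine ⟨e, he, ?_⟩
    rw [mathonConics_eq_cubicFamily]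
    refine Iso.trans (iso_normal_form hK hp₂ ht ?_ ?_) hiso₃
    · simpa [trace_pow hK h5] using he1
    · exact hic

theorem ncard_mathonConics (hK : Fintype.card K = 32) (hw : IsPrimitiveRoot w 31)
    (h5 : w ^ 5 = w ^ 2 + 1) (e : ℕ × ℕ × ℕ) : (mathonConics w e).ncard = 7 := by
  rw [mathonConics_eq_cubicFamily, ncard_cubicFamily, card_closure hK hw h5]

theorem mathonConics_six_nineteen_eight (hK : Fintype.card K = 32) (hw : IsPrimitiveRoot w 31)
    (h5 : w ^ 5 = w ^ 2 + 1) : mathonConics w (6, 19, 8) =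
      {⟨1, 1, 1⟩, ⟨1, 1, w⟩, ⟨1, 1, w + 1⟩, ⟨1, w ^ 12, w ^ 25⟩, ⟨1, w ^ 6, w ^ 21⟩,
        ⟨1, w ^ 18, w ^ 16⟩, ⟨1, w ^ 20, w ^ 9⟩} := by
  have := charP_two K
  have hw0 : w ≠ 0 := hw.ne_zero (by norm_num)
  have h31 : w ^ 31 = 1 := hw.pow_eq_one
  let β (n : ℕ) : K := w ^ 6 + w ^ 19 * w ^ n + w ^ 8 * (w ^ n) ^ 3
  have h : mathonConics w (6, 19, 8) =
      {c | ∃ n ∈ groupExponents, c = ⟨1, β n, w ^ n⟩} := by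
    ext c
    constructor
    · rintro ⟨l, hl, h0, rfl⟩
      obtain ⟨n, hn, rfl⟩ := ((mem_closure_iff hK hw h5).1 hl).resolve_left h0
      exact ⟨n, hn, rfl⟩
    · rintro ⟨n, hn, rfl⟩
      exact ⟨_, (mem_closure_iff hK hw h5).2 (Or.inr ⟨n, hn, rfl⟩), pow_ne_zero n hw0, rfl⟩
  have b0 : β 0 = 1 := by simp only [β]; grind
  have b1 : β 1 = 1 := by simp only [β]; grind
  have b18 : β 18 = 1 := by
    simp only [β]
    grind
  have b25 : β 25 = w ^ 12 := by
    simp only [β]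
    grind
  have b21 : β 21 = w ^ 6 := by
    simp only [β]
    grind
  have b16 : β 16 = w ^ 18 := by
    simp only [β]
    grind
  have b9 : β 9 = w ^ 20 := by
    simp only [β]
    grind
  have h18 : w ^ 18 = w + 1 := by grind
  rw [h]
  ext c
  simp only [groupExponents, List.mem_cons, List.not_mem_nil, or_false, exists_eq_or_imp,
    exists_eq_left, b0, b1, b9, b16, b18, b21, b25, h18, pow_zero, pow_one, Set.mem_ofPred_eq,
    Set.mem_insert_iff, Set.mem_singleton_iff]
  tauto

theorem card_properMathonClasses (hK : Fintype.card K = 32) :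
    Nat.card (ProperMathonClasses K 8) = 3 := by
  have := charP_two K
  obtain ⟨w, hw, h18⟩ := exists_primitive_element hK
  have h5 := pow_five_of_pow_eighteen hw.pow_eq_one h18
  let F (e : mathonExponents) : ProperMathonClasses K 8 :=
    Quotient.mk (properMathonSetoid K 8) ⟨_, isProperMathonArc_mathonConics hK hw h5 e.2⟩
  have hF : Function.Bijective F := by
    constructor
    · intro e e' h
      by_contra hne
      exact not_iso_mathonConics hK hw h5 e.2 e'.2 (fun h => hne (Subtype.ext h))
        (Quotient.exact h)
    · intro c
      induction c using Quotient.inductionOn with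
      | h S =>
        obtain ⟨e, he, hiso⟩ := exists_iso_mathonConics hK hw h5 S.2
        exact ⟨⟨e, he⟩, Quotient.sound hiso⟩
  rw [← Nat.card_eq_of_bijective F hF, Nat.card_eq_fintype_card, Fintype.card_coe]
  decide

end Classification

end PG2

theorem mainTheorem9 {K : Type*} [Field K] [Fintype K] [Algebra (ZMod 2) K]
    (hK : Fintype.card K = 32) :
    Nat.card (PG2.ProperMathonClasses K 8) = 3 ∧
    (∃ w : K, IsPrimitiveRoot w 31 ∧ w ^ 18 + w = 1) ∧
    ∀ w : K, IsPrimitiveRoot w 31 → w ^ 18 + w = 1 →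
      (∀ e ∈ PG2.mathonExponents,
        PG2.IsClosedConicSet (PG2.mathonConics w e) ∧
        (PG2.mathonConics w e).ncard = 7 ∧
        PG2.IsProperMathonArc 8 (PG2.arcOfConics (PG2.mathonConics w e))) ∧
      (∀ e ∈ PG2.mathonExponents, ∀ e' ∈ PG2.mathonExponents, e ≠ e' →
        ¬ PG2.Iso (PG2.arcOfConics (PG2.mathonConics w e))
          (PG2.arcOfConics (PG2.mathonConics w e'))) ∧
      (∀ S : Set (PG2 K), PG2.IsProperMathonArc 8 S →
        ∃ e ∈ PG2.mathonExponents, PG2.Iso (PG2.arcOfConics (PG2.mathonConics w e)) S) ∧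
      PG2.mathonConics w (6, 19, 8) =
        {⟨1, 1, 1⟩, ⟨1, 1, w⟩, ⟨1, 1, w + 1⟩, ⟨1, w ^ 12, w ^ 25⟩, ⟨1, w ^ 6, w ^ 21⟩,
          ⟨1, w ^ 18, w ^ 16⟩, ⟨1, w ^ 20, w ^ 9⟩} := by
  have := PG2.charP_two K
  refine ⟨PG2.card_properMathonClasses hK, PG2.exists_primitive_element hK, fun w hw h => ?_⟩
  have h5 := PG2.pow_five_of_pow_eighteen hw.pow_eq_one h
  exact ⟨fun e he => ⟨PG2.isClosedConicSet_mathonConics hK hw h5 he,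
    PG2.ncard_mathonConics hK hw h5 e, PG2.isProperMathonArc_mathonConics hK hw h5 he⟩,
    fun e he e' he' => PG2.not_iso_mathonConics hK hw h5 he he',
    fun S => PG2.exists_iso_mathonConics hK hw h5,
    PG2.mathonConics_six_nineteen_eight hK hw h5⟩
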